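/- Let $Q$ be a polynomial ring over a field $k$, let $\mathfrak m$ be the ideal generated by the variables, and let $I\subsetneq Q$ be a proper ideal minimally generated by monomials $m_1,\dots,m_q$. For $\tau\subseteq[q]=\{1,\dots,q\}$ put $m_\tau=\operatorname{lcm}(m_j: j\in\tau)$ (so $m_\emptyset=1$), and let $$\operatorname{scarf}(I)=\inf\{\,|\tau| : \tau\subseteq[q],\ m_\tau=m_{\tau'}\text{ for some }\tau'\subseteq[q],\ \tau'\ne\tau\,\}\in\mathbb N\cup\{\infty\}.$$ The Taylor complex $\mathcal T$ has in degree $i$ the free $Q$-module with basis $\{\epsilon_\tau:\tau\subseteq[q],\ |\tau|=i\}$, and differential $\partial(\epsilon_\tau)=\sum_{j\in\tau}(-1)^{|\{i\in\tau\,:\,i<j\}|}\frac{m_\tau}{m_{\tau\setminus\{j\}}}\,\epsilon_{\tau\setminus\{j\}}$. A pivot complex is either $\mathcal T$ itself or, for some $S\subseteq[q]$ with $|S|\ge2$, the subcomplex of $\mathcal T$ spanned by the $\epsilon_\tau$ with $S\not\subseteq\tau$. A free resolution of a $Q$-module $M$ is a complex $\cdots\to F_1\to F_0\to0$ of finitely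 generated free $Q$-modules with $H_0\cong M$ and $H_i=0$ for $i>0$; it is minimal if $\partial(F_{i+1})\subseteq\mathfrak mF_i$ for all $i\geq 0$. A minimal pivot resolution of $Q/I$ is a pivot complex that is a minimal free resolution of $Q/I$. Let $\beta_i^Q(Q/I)$ be the rank of the $i$-th module in a minimal free resolution of $Q/I$, with $\beta_i^Q(Q/I)=0$ for $i<0$. Then, for every $i\in\mathbb Z$, $$\beta_i^Q(Q/I)\le\binom qi-\binom{q-\operatorname{scarf}(I)}{i-\operatorname{scarf}(I)},$$ where a binomial coefficient with negative lower entry is $0$ and the last binomial coefficient is $0$ if $\operatorname{scarf}(I)=\infty$. Moreover, equality holds for all $i\in\mathbb Z$ if and only if $Q/I$ has a minimal pivot resolution. -/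

import Mathlib

/-! ## Free resolutions, minimality and Betti numbers -/

section Resolutions

universe u v w

variable {R : Type u} [CommRing R]

/-- The sequence `⋯ → F 2 → F 1 → F 0 → 0` of finitely generated free `R`-modules is a free
resolution of `M`: its homology is zero in all positive degrees (exactness at `F (i + 1)`, which
includes `d i ∘ d (i + 1) = 0`), and its homology in degree zero is isomorphic to `M`. -/
structure IsFreeResolution (M : Type v) [AddCommGroup M] [Module R M]
    (F : ℕ → Type w) [∀ i, AddCommGroup (F i)] [∀ i, Module R (F i)]
    (d : ∀ i, F (i + 1) →ₗ[R] F i) : Prop where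
  free : ∀ i, Module.Free R (F i)
  finite : ∀ i, Module.Finite R (F i)
  exact : ∀ i, Function.Exact (d (i + 1)) (d i)
  homology_zero : Nonempty ((F 0 ⧸ LinearMap.range (d 0)) ≃ₗ[R] M)

/-- A free resolution is minimal with respect to the ideal `𝔪` if `∂(F_{i+1}) ⊆ 𝔪 F_i`
for all `i`. -/
structure IsMinimalFreeResolution (𝔪 : Ideal R) (M : Type v) [AddCommGroup M] [Module R M]
    (F : ℕ → Type w) [∀ i, AddCommGroup (F i)] [∀ i, Module R (F i)]
    (d : ∀ i, F (i + 1) →ₗ[R] F i) : Prop extends IsFreeResolution M F d where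
  minimal : ∀ i, LinearMap.range (d i) ≤ 𝔪 • (⊤ : Submodule R (F i))

/-- The `i`-th Betti number of `M`: the rank `n_i` of the `i`-th module in a minimal free resolution
`⋯ → R^{n_1} → R^{n_0} → 0` of `M` (and `0` for negative `i`). All minimal free resolutions of
`M` have the same ranks, so for a module that has a minimal free resolution the set below has
exactly one element. -/
noncomputable def bettiNumber (𝔪 : Ideal R) (M : Type v) [AddCommGroup M] [Module R M]
    (i : ℤ) : ℕ :=
  sInf {b : ℕ | ∃ (n : ℕ → ℕ) (d : ∀ j, (Fin (n (j + 1)) → R) →ₗ[R] (Fin (n j) → R)),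
    IsMinimalFreeResolution 𝔪 M (fun j => Fin (n j) → R) d ∧
      b = if 0 ≤ i then n i.toNat else 0}

end Resolutions

/-! ## Monomial ideals, the Taylor complex, pivot complexes and the Scarf number

The monomials `m_1, …, m_q` are given by their exponent vectors `a : Fin q → σ →₀ ℕ`. -/

section Pivot

variable {σ : Type*} {q : ℕ}

/-- The ideal generated by the variables. -/
noncomputable def irrelevantIdeal (σ k : Type*) [Field k] : Ideal (MvPolynomial σ k) :=
  Ideal.span (Set.range MvPolynomial.X)

/-- `I` is minimally generated by the monomials with exponents `a 1, …, a q`: they generate `I`,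
and no proper subfamily of them does. -/
def IsMinimallyGenerated {k : Type*} [Field k] (I : Ideal (MvPolynomial σ k))
    (a : Fin q → σ →₀ ℕ) : Prop :=
  I = Ideal.span (Set.range fun j => MvPolynomial.monomial (a j) (1 : k)) ∧
    ∀ S : Set (Fin q),
      I = Ideal.span ((fun j => MvPolynomial.monomial (a j) (1 : k)) '' S) → S = Set.univ

/-- The exponent vector of `m_τ = lcm (m_j : j ∈ τ)`, the coordinatewise maximum of the exponent
vectors of the `m_j`; it is zero, that is `m_∅ = 1`, for `τ = ∅`. -/
noncomputable def lcmExponent (a : Fin q → σ →₀ ℕ) (τ : Finset (Fin q)) : σ →₀ ℕ :=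
  τ.sup a

/-- The Scarf number: the least cardinality of an index set `τ` such that `m_τ = m_τ'` for some
index set `τ' ≠ τ`; it is `∞` if there is none. -/
noncomputable def scarfNumber (a : Fin q → σ →₀ ℕ) : ℕ∞ :=
  sInf {t : ℕ∞ | ∃ τ τ' : Finset (Fin q),
    τ ≠ τ' ∧ (τ.card : ℕ∞) = t ∧ lcmExponent a τ = lcmExponent a τ'}

/-- The coefficient of `ε_τ'` in the Taylor differential
`∂ ε_τ = ∑_{j ∈ τ} (-1)^{#{i ∈ τ : i < j}} (m_τ / m_{τ ∖ j}) ε_{τ ∖ j}`. -/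
noncomputable def taylorCoeff (k : Type*) [Field k] (a : Fin q → σ →₀ ℕ)
    (τ τ' : Finset (Fin q)) : MvPolynomial σ k :=
  ∑ j ∈ τ, if τ' = τ.erase j then
    (-1) ^ (τ.filter (· < j)).card *
      MvPolynomial.monomial (lcmExponent a τ - lcmExponent a τ') 1
  else 0

/-- The basis of the degree `i` part of the subcomplex `𝒯_Ω` of the Taylor complex: the index sets
of cardinality `i` in `Ω`. -/
abbrev TaylorIndex (Ω : Finset (Finset (Fin q))) (i : ℕ) : Type :=
  {τ : Finset (Fin q) // τ ∈ Ω ∧ τ.card = i}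

/-- The degree `i` part of `𝒯_Ω`, free on `TaylorIndex Ω i`. -/
abbrev TaylorModule (σ k : Type*) [Field k] (Ω : Finset (Finset (Fin q))) (i : ℕ) : Type _ :=
  TaylorIndex Ω i → MvPolynomial σ k

/-- The differential of `𝒯_Ω`, the restriction of the Taylor differential (for `Ω` closed under
taking subsets). -/
noncomputable def taylorDifferential (k : Type*) [Field k] (a : Fin q → σ →₀ ℕ)
    (Ω : Finset (Finset (Fin q))) (i : ℕ) :
    TaylorModule σ k Ω (i + 1) →ₗ[MvPolynomial σ k] TaylorModule σ k Ω i :=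
  Matrix.mulVecLin (Matrix.of fun (τ' : TaylorIndex Ω i) (τ : TaylorIndex Ω (i + 1)) =>
    taylorCoeff k a τ.1 τ'.1)

/-- The families `Ω` for which `𝒯_Ω` is a pivot complex: the whole power set, or, for some index
set `S = {i_1, …, i_l}` with `l ≥ 2`, the family of all index sets that do not contain `S`. -/
def IsPivotFamily (Ω : Finset (Finset (Fin q))) : Prop :=
  Ω = Finset.univ ∨
    ∃ S : Finset (Fin q), 2 ≤ S.card ∧ Ω = Finset.univ.filter fun τ => ¬ S ⊆ τ

/-- `Q/I` has a minimal pivot resolution: some pivot complex is a minimal free resolution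
of `Q/I`. -/
def HasMinimalPivotResolution {k : Type*} [Field k] (I : Ideal (MvPolynomial σ k))
    (a : Fin q → σ →₀ ℕ) : Prop :=
  ∃ Ω : Finset (Finset (Fin q)), IsPivotFamily Ω ∧
    IsMinimalFreeResolution (irrelevantIdeal σ k) (MvPolynomial σ k ⧸ I)
      (TaylorModule σ k Ω) (taylorDifferential k a Ω)

end Pivot

/-- The binomial coefficient with integer entries, zero if the lower entry is negative. -/
noncomputable def intBinom (n i : ℤ) : ℤ :=
  if 0 ≤ i then Ring.choose n i.toNat else 0

/-- `binom (q - s) (i - s)`, with the convention `binom (-∞) (-∞) = 0` for `s = ∞`. -/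
noncomputable def shiftedBinom (q : ℕ) (i : ℤ) (s : ℕ∞) : ℤ :=
  if s = ⊤ then 0 else intBinom ((q : ℤ) - (s.toNat : ℤ)) (i - (s.toNat : ℤ))

/-! ### Comparison of free resolutions modulo the maximal ideal. -/

section Comparison

open scoped TensorProduct

universe u v w w'

variable {R : Type u} [CommRing R]

/-! Some pivot complex always resolves `Q/I` and has exactly the ranks on the right-hand side. If
the Scarf number is infinite, it is the Taylor complex. Otherwise, a set `S` attaining the Scarf
number admits a generator `m_j` with `j ∉ S` and `m_j ∣ m_S`: a `τ' ≠ S` with the same lcm cannot be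
a proper subset of `S`, since it would be a smaller competitor (`exists_card_eq_scarfNumber`).
Minimal generation and properness give `|S| ≥ 2`. In each multidegree divisible by a generator, the
admissible index sets not containing `S` form a cone, with apex `j` when `m_S` divides the
multidegree and with any dividing generator otherwise (`isConical_pivotFamily`). Coning is a
contracting homotopy, so the pivot complex of `S` is a resolution; its ranks count the sets that do
not contain `S`.

A minimal resolution is modulo `𝔪` a termwise retract of every free resolution. This yields the
inequality, and equality of all ranks forces the pivot resolution to be minimal
(`IsMinimalFreeResolution.of_finrank_eq`).

Conversely, let a pivot complex be a minimal resolution. If it is the Taylor complex, no two lcms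
coincide. If it is the complex of `S`, then the cycle `∂ε_S` must bound, which forces a generator
outside `S` to divide `m_S`; together with minimality this gives Scarf number `|S|`
(`exists_notMem_le_lcmExponent_of_exact`, `scarfNumber_eq_card`).

Betti numbers are meaningful only once a minimal resolution exists; one is obtained from the Taylor
complex by cancelling unit coefficients one at a time (`IsScalarResolution.cancel`). -/

theorem LinearMap.exists_comp_eq_of_range_le {P A B : Type*} [AddCommGroup P] [Module R P]
    [AddCommGroup A] [Module R A] [AddCommGroup B] [Module R B] [Module.Projective R P]
    (d : A →ₗ[R] B) (g : P →ₗ[R] B) (h : LinearMap.range g ≤ LinearMap.range d) :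
    ∃ f : P →ₗ[R] A, d ∘ₗ f = g := by
  obtain ⟨f, hf⟩ := Module.projective_lifting_property d.rangeRestrict
    (g.codRestrict (LinearMap.range d) fun x => h ⟨x, rfl⟩) d.surjective_rangeRestrict
  refine ⟨f, LinearMap.ext fun x => ?_⟩
  simpa using congrArg Subtype.val (LinearMap.congr_fun hf x)

variable {F : ℕ → Type w} [∀ i, AddCommGroup (F i)] [∀ i, Module R (F i)]
  {d : ∀ i, F (i + 1) →ₗ[R] F i}
  {G : ℕ → Type w'} [∀ i, AddCommGroup (G i)] [∀ i, Module R (G i)]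
  {d' : ∀ i, G (i + 1) →ₗ[R] G i}

/-- A map in degree zero that is compatible with the images of the differentials extends to a
chain map from a complex of projectives to an acyclic complex. -/
theorem exists_chain_map_lift [∀ i, Module.Projective R (F i)]
    (hd : ∀ i x, d i (d (i + 1) x) = 0) (hd' : ∀ i, Function.Exact (d' (i + 1)) (d' i))
    (f₀ : F 0 →ₗ[R] G 0) (h₀ : ∀ x, f₀ (d 0 x) ∈ LinearMap.range (d' 0)) :
    ∃ f : ∀ i, F i →ₗ[R] G i, f 0 = f₀ ∧ ∀ i x, d' i (f (i + 1) x) = f i (d i x) := by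
  have step : ∀ (i : ℕ) (g : {g : F i →ₗ[R] G i // ∀ x, g (d i x) ∈ LinearMap.range (d' i)}),
      ∃ g' : {g : F (i + 1) →ₗ[R] G (i + 1) //
        ∀ x, g (d (i + 1) x) ∈ LinearMap.range (d' (i + 1))},
        ∀ x, d' i (g'.1 x) = g.1 (d i x) := by
    rintro i ⟨g, hg⟩
    obtain ⟨f, hf⟩ := LinearMap.exists_comp_eq_of_range_le (d' i) (g ∘ₗ d i) (by
      rintro _ ⟨x, rfl⟩
      exact hg x)
    have hf' : ∀ x, d' i (f x) = g (d i x) := fun x => LinearMap.congr_fun hf x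
    refine ⟨⟨f, fun x => ?_⟩, hf'⟩
    exact (hd' i _).1 (by rw [hf', hd, map_zero])
  choose next hnext using step
  -- The recursion carries the lifting condition along with the map, since it is what makes the next
  -- step solvable.
  let s : ∀ i, {g : F i →ₗ[R] G i // ∀ x, g (d i x) ∈ LinearMap.range (d' i)} :=
    fun i => Nat.rec ⟨f₀, h₀⟩ (fun i g => next i g) i
  exact ⟨fun i => (s i).1, rfl, fun i x => hnext i (s i) x⟩

/-- A chain endomorphism of a minimal resolution by projectives that vanishes on homology has
image in `𝔪 F`. -/
theorem mem_smul_top_of_chain_map [∀ i, Module.Projective R (F i)] {𝔪 : Ideal R}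
    (hd : ∀ i, Function.Exact (d (i + 1)) (d i))
    (hmin : ∀ i, LinearMap.range (d i) ≤ 𝔪 • (⊤ : Submodule R (F i)))
    (φ : ∀ i, F i →ₗ[R] F i) (hφ : ∀ i x, d i (φ (i + 1) x) = φ i (d i x))
    (h₀ : ∀ x, φ 0 x ∈ LinearMap.range (d 0)) (i : ℕ) (x : F i) :
    φ i x ∈ 𝔪 • (⊤ : Submodule R (F i)) := by
  -- A null-homotopy is built degree by degree. Knowing `φ = d h` on boundaries only is enough to
  -- construct the next map, with `φ = d h' + h d`; both summands land in `𝔪 F`.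
  suffices H : ∀ i, ∃ h : F i →ₗ[R] F (i + 1), (∀ x, φ i (d i x) = d i (h (d i x))) ∧
      ∀ x, φ i x ∈ 𝔪 • (⊤ : Submodule R (F i)) from (H i).choose_spec.2 x
  intro i
  induction i with
  | zero =>
    obtain ⟨h, hh⟩ := LinearMap.exists_comp_eq_of_range_le (d 0) (φ 0) (by
      rintro _ ⟨x, rfl⟩
      exact h₀ x)
    exact ⟨h, fun x => (LinearMap.congr_fun hh _).symm, fun x => hmin 0 (h₀ x)⟩
  | succ i ih =>
    obtain ⟨h, hh, -⟩ := ih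
    obtain ⟨h', hh'⟩ := LinearMap.exists_comp_eq_of_range_le (d (i + 1)) (φ (i + 1) - h ∘ₗ d i) (by
      rintro _ ⟨x, rfl⟩
      refine (hd i _).1 ?_
      simp [hφ, hh])
    have hh'' : ∀ x, d (i + 1) (h' x) = φ (i + 1) x - h (d i x) :=
      fun x => LinearMap.congr_fun hh' x
    refine ⟨h', fun x => ?_, fun x => ?_⟩
    · rw [hh'', (hd i).apply_apply_eq_zero, map_zero, sub_zero]
    · rw [← sub_add_cancel (φ (i + 1) x) (h (d i x)), ← hh'']
      refine add_mem (hmin _ ⟨_, rfl⟩) ?_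
      have h1 : (𝔪 • (⊤ : Submodule R (F i))).map h ≤ 𝔪 • (⊤ : Submodule R (F (i + 1))) := by
        rw [Submodule.map_smul'']
        exact Submodule.smul_mono le_rfl le_top
      exact h1 ⟨_, hmin i ⟨x, rfl⟩, rfl⟩

variable {M : Type v} [AddCommGroup M] [Module R M]

/-- Over a common module, a minimal free resolution is, modulo `𝔪`, a retract of any other free
resolution. -/
theorem exists_chain_maps_retract {𝔪 : Ideal R} (hF : IsMinimalFreeResolution 𝔪 M F d)
    (hG : IsFreeResolution M G d') :
    ∃ (f : ∀ i, F i →ₗ[R] G i) (g : ∀ i, G i →ₗ[R] F i),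
      (∀ i x, d' i (f (i + 1) x) = f i (d i x)) ∧
      ∀ i x, x - g i (f i x) ∈ 𝔪 • (⊤ : Submodule R (F i)) := by
  have hFf := hF.free
  have hGf := hG.free
  obtain ⟨e⟩ := hF.homology_zero
  obtain ⟨e'⟩ := hG.homology_zero
  let p : F 0 →ₗ[R] M := e.toLinearMap ∘ₗ Submodule.mkQ _
  let p' : G 0 →ₗ[R] M := e'.toLinearMap ∘ₗ Submodule.mkQ _
  have hp : Function.Surjective p := e.surjective.comp (Submodule.mkQ_surjective _)
  have hp' : Function.Surjective p' := e'.surjective.comp (Submodule.mkQ_surjective _)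
  have kp : ∀ x, p x = 0 ↔ x ∈ LinearMap.range (d 0) := fun x => by simp [p]
  have kp' : ∀ x, p' x = 0 ↔ x ∈ LinearMap.range (d' 0) := fun x => by simp [p']
  obtain ⟨f₀, hf₀⟩ := Module.projective_lifting_property p' p hp'
  obtain ⟨g₀, hg₀⟩ := Module.projective_lifting_property p p' hp
  have hf₀' : ∀ x, p' (f₀ x) = p x := fun x => LinearMap.congr_fun hf₀ x
  have hg₀' : ∀ x, p (g₀ x) = p' x := fun x => LinearMap.congr_fun hg₀ x
  obtain ⟨f, hf0, hf⟩ := exists_chain_map_lift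
    (fun i x => (hF.exact i).apply_apply_eq_zero x) hG.exact f₀
    (fun x => by rw [← kp', hf₀', kp]; exact ⟨x, rfl⟩)
  obtain ⟨g, hg0, hg⟩ := exists_chain_map_lift
    (fun i x => (hG.exact i).apply_apply_eq_zero x) hF.exact g₀
    (fun x => by rw [← kp, hg₀', kp']; exact ⟨x, rfl⟩)
  refine ⟨f, g, hf, fun i x => ?_⟩
  refine mem_smul_top_of_chain_map hF.exact hF.minimal
    (fun i => LinearMap.id - g i ∘ₗ f i) (fun i x => ?_) (fun x => ?_) i x
  · simp [hg, hf]
  · rw [← kp]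
    simp [hf0, hg0, hf₀', hg₀']

theorem TensorProduct.tmul_eq_zero_of_mem_smul_top {𝔪 : Ideal R} {B : Type*} [AddCommGroup B]
    [Module R B] {b : B} (h : b ∈ 𝔪 • (⊤ : Submodule R B)) (r : R ⧸ 𝔪) : r ⊗ₜ[R] b = 0 := by
  refine Submodule.smul_induction_on h (fun s hs x _ => ?_) fun x y hx hy => ?_
  · rw [← TensorProduct.smul_tmul, _root_.Algebra.smul_def,
      Ideal.Quotient.algebraMap_eq, Ideal.Quotient.eq_zero_iff_mem.2 hs, zero_mul,
      TensorProduct.zero_tmul]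
  · rw [TensorProduct.tmul_add, hx, hy, add_zero]

theorem TensorProduct.mem_smul_top_of_tmul_eq_zero {𝔪 : Ideal R} {B : Type*} [AddCommGroup B]
    [Module R B] {b : B} (h : (1 : R ⧸ 𝔪) ⊗ₜ[R] b = 0) : b ∈ 𝔪 • (⊤ : Submodule R B) := by
  have h1 := TensorProduct.quotTensorEquivQuotSMul_mk_tmul 𝔪 (1 : R) b
  rw [one_smul, map_one, h, map_zero] at h1
  exact (Submodule.Quotient.mk_eq_zero _).1 h1.symm

theorem finrank_baseChange_quotient (𝔪 : Ideal R) [𝔪.IsMaximal] (A : Type*) [AddCommGroup A]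
    [Module R A] [Module.Free R A] :
    Module.finrank (R ⧸ 𝔪) ((R ⧸ 𝔪) ⊗[R] A) = Module.finrank R A := by
  have : Nontrivial R := (Ideal.Quotient.mk 𝔪).domain_nontrivial
  exact Module.finrank_baseChange

theorem LinearMap.baseChange_comp_eq_id {𝔪 : Ideal R} {A B : Type*} [AddCommGroup A] [Module R A]
    [AddCommGroup B] [Module R B] {f : A →ₗ[R] B} {g : B →ₗ[R] A}
    (h : ∀ x, x - g (f x) ∈ 𝔪 • (⊤ : Submodule R A)) (y : (R ⧸ 𝔪) ⊗[R] A) :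
    g.baseChange (R ⧸ 𝔪) (f.baseChange (R ⧸ 𝔪) y) = y := by
  induction y with
  | zero => simp
  | add x y hx hy => rw [map_add, map_add, hx, hy]
  | tmul r x =>
    rw [LinearMap.baseChange_tmul, LinearMap.baseChange_tmul, eq_comm, ← sub_eq_zero,
      ← TensorProduct.tmul_sub]
    exact TensorProduct.tmul_eq_zero_of_mem_smul_top (h x) r

variable {𝔪 : Ideal R}

/-- The ranks in a minimal free resolution are minimal. -/
theorem IsMinimalFreeResolution.finrank_le [𝔪.IsMaximal] (hF : IsMinimalFreeResolution 𝔪 M F d)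
    (hG : IsFreeResolution M G d') (i : ℕ) :
    Module.finrank R (F i) ≤ Module.finrank R (G i) := by
  have hFf := hF.free
  have hGf := hG.free
  have hFn := hF.finite
  have hGn := hG.finite
  let _ := Ideal.Quotient.field 𝔪
  obtain ⟨f, g, -, h⟩ := exists_chain_maps_retract hF hG
  rw [← finrank_baseChange_quotient 𝔪 (F i), ← finrank_baseChange_quotient 𝔪 (G i)]
  exact LinearMap.finrank_le_finrank_of_injective (f := (f i).baseChange (R ⧸ 𝔪))
    (Function.LeftInverse.injective (LinearMap.baseChange_comp_eq_id (h i)))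

/-- A free resolution with the same ranks as a minimal one is minimal. -/
theorem IsMinimalFreeResolution.of_finrank_eq [𝔪.IsMaximal] (hF : IsMinimalFreeResolution 𝔪 M F d)
    (hG : IsFreeResolution M G d')
    (h : ∀ i, Module.finrank R (F i) = Module.finrank R (G i)) :
    IsMinimalFreeResolution 𝔪 M G d' := by
  have hFf := hF.free
  have hGf := hG.free
  have hFn := hF.finite
  have hGn := hG.finite
  let _ := Ideal.Quotient.field 𝔪
  obtain ⟨f, g, hf, hgf⟩ := exists_chain_maps_retract hF hG
  refine ⟨hG, fun i => ?_⟩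
  -- Modulo `𝔪`, `f` is a split injection between spaces of equal finite dimension. Being a
  -- surjective chain map from a complex with zero differential, it forces the differential of `G`
  -- to vanish modulo `𝔪`.
  have hs : Function.Surjective ((f (i + 1)).baseChange (R ⧸ 𝔪)) := by
    refine (LinearMap.injective_iff_surjective_of_finrank_eq_finrank ?_).1
      (Function.LeftInverse.injective (LinearMap.baseChange_comp_eq_id (hgf (i + 1))))
    rw [finrank_baseChange_quotient, finrank_baseChange_quotient, h]
  rintro _ ⟨y, rfl⟩
  refine TensorProduct.mem_smul_top_of_tmul_eq_zero ?_
  obtain ⟨x, hx⟩ := hs (1 ⊗ₜ y)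
  rw [← LinearMap.baseChange_tmul, ← hx]
  clear hx
  induction x with
  | zero => simp
  | add x y hx hy => rw [map_add, map_add, hx, hy, add_zero]
  | tmul r x =>
    rw [LinearMap.baseChange_tmul, LinearMap.baseChange_tmul, hf, ← LinearMap.baseChange_tmul,
      TensorProduct.tmul_eq_zero_of_mem_smul_top (hF.minimal i ⟨x, rfl⟩), map_zero]

/-- Free resolutions can be transported along isomorphisms of their terms. -/
theorem IsFreeResolution.congr (hF : IsFreeResolution M F d) (e : ∀ i, F i ≃ₗ[R] G i)
    (he : ∀ i x, d' i (e (i + 1) x) = e i (d i x)) : IsFreeResolution M G d' := by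
  have hFf := hF.free
  have hFn := hF.finite
  obtain ⟨e₀⟩ := hF.homology_zero
  refine ⟨fun i => Module.Free.of_equiv (e i), fun i => Module.Finite.equiv (e i),
    fun i y => ?_, ⟨?_⟩⟩
  · obtain ⟨x, rfl⟩ := (e (i + 1)).surjective y
    rw [he, LinearEquiv.map_eq_zero_iff, hF.exact i x]
    constructor
    · rintro ⟨z, rfl⟩
      exact ⟨e _ z, he _ _⟩
    · rintro ⟨z, hz⟩
      obtain ⟨z, rfl⟩ := (e (i + 1 + 1)).surjective z
      rw [he] at hz
      exact ⟨z, (e (i + 1)).injective hz⟩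
  · refine (Submodule.Quotient.equiv _ _ (e 0) ?_).symm ≪≫ₗ e₀
    ext y
    constructor
    · rintro ⟨_, ⟨x, rfl⟩, rfl⟩
      exact ⟨e 1 x, he 0 x⟩
    · rintro ⟨x, rfl⟩
      obtain ⟨x, rfl⟩ := (e 1).surjective x
      exact ⟨d 0 x, ⟨x, rfl⟩, (he 0 x).symm⟩

/-- The Betti numbers are the ranks in any minimal free resolution. -/
theorem IsMinimalFreeResolution.bettiNumber_eq [𝔪.IsMaximal]
    (hF : IsMinimalFreeResolution 𝔪 M F d) (i : ℤ) :
    bettiNumber 𝔪 M i = if 0 ≤ i then Module.finrank R (F i.toNat) else 0 := by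
  have : Nontrivial R := (Ideal.Quotient.mk 𝔪).domain_nontrivial
  have hFf := hF.free
  have hFn := hF.finite
  let e : ∀ i, F i ≃ₗ[R] (Fin (Module.finrank R (F i)) → R) :=
    fun i => (Module.finBasis R (F i)).equivFun
  have hG : IsFreeResolution M (fun i => Fin (Module.finrank R (F i)) → R)
      (fun i => (e i).toLinearMap ∘ₗ d i ∘ₗ (e (i + 1)).symm.toLinearMap) :=
    hF.toIsFreeResolution.congr e fun i x => by simp
  have hG' := hF.of_finrank_eq hG fun i => by simp
  refine le_antisymm (Nat.sInf_le ⟨_, _, hG', rfl⟩) ?_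
  -- Nonemptiness matters here, as the infimum of the empty set would be `0`: the infimum is the
  -- rank in an actual minimal resolution, to which `finrank_le` applies.
  obtain ⟨n, d', hn, hb⟩ := Nat.sInf_mem (s := {b : ℕ | ∃ (n : ℕ → ℕ)
    (d : ∀ j, (Fin (n (j + 1)) → R) →ₗ[R] (Fin (n j) → R)),
    IsMinimalFreeResolution 𝔪 M (fun j => Fin (n j) → R) d ∧
      b = if 0 ≤ i then n i.toNat else 0}) ⟨_, _, _, hG', rfl⟩
  rw [bettiNumber, hb]
  split_ifs
  · simpa using hF.finrank_le hn.toIsFreeResolution i.toNat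
  · rfl

end Comparison

/-! ### The Taylor differential, its signs, and the cone homotopy. -/

section TotalTaylor

open MvPolynomial

variable {σ k : Type*} [Field k] {q : ℕ}

theorem lcmExponent_le_iff {a : Fin q → σ →₀ ℕ} {τ : Finset (Fin q)} {u : σ →₀ ℕ} :
    lcmExponent a τ ≤ u ↔ ∀ j ∈ τ, a j ≤ u := Finset.sup_le_iff

theorem lcmExponent_mono (a : Fin q → σ →₀ ℕ) {τ τ' : Finset (Fin q)} (h : τ ⊆ τ') :
    lcmExponent a τ ≤ lcmExponent a τ' := Finset.sup_mono h

/-- The incidence sign `(-1)^#{i ∈ τ : i < j}`. -/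
def incidenceSign (k : Type*) [Ring k] (j : Fin q) (τ : Finset (Fin q)) : k :=
  (-1) ^ (τ.filter (· < j)).card

theorem incidenceSign_mul_self (j : Fin q) (τ : Finset (Fin q)) :
    incidenceSign k j τ * incidenceSign k j τ = 1 := by
  rw [incidenceSign, ← mul_pow]; simp

theorem incidenceSign_insert_self (j : Fin q) (τ : Finset (Fin q)) :
    incidenceSign k j (insert j τ) = incidenceSign k j τ := by
  simp [incidenceSign, Finset.filter_insert]

theorem incidenceSign_erase_self (j : Fin q) (τ : Finset (Fin q)) :
    incidenceSign k j (τ.erase j) = incidenceSign k j τ := by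
  rw [incidenceSign, incidenceSign, Finset.filter_erase, Finset.erase_eq_of_notMem (by simp)]

theorem incidenceSign_insert {i j : Fin q} {τ : Finset (Fin q)} (hj : j ∉ τ) :
    incidenceSign k i (insert j τ) = (if j < i then -1 else 1) * incidenceSign k i τ := by
  unfold incidenceSign
  rw [Finset.filter_insert]
  split_ifs
  · rw [Finset.card_insert_of_notMem (by simp [hj]), pow_succ']
  · simp

theorem incidenceSign_eq_erase {i j : Fin q} {τ : Finset (Fin q)} (hj : j ∈ τ) :
    incidenceSign k i τ = (if j < i then -1 else 1) * incidenceSign k i (τ.erase j) := by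
  conv_lhs => rw [← Finset.insert_erase hj]
  exact incidenceSign_insert (Finset.notMem_erase j τ)

/-- Of two distinct indices exactly one is smaller, and deleting it flips the sign attached to the
other; deleting the larger one changes nothing. -/
theorem incidenceSign_erase_antisymm {i j : Fin q} {τ : Finset (Fin q)} (hi : i ∈ τ) (hj : j ∈ τ)
    (hij : i ≠ j) :
    incidenceSign k i τ * incidenceSign k j (τ.erase i) =
      -(incidenceSign k j τ * incidenceSign k i (τ.erase j)) := by
  rw [incidenceSign_eq_erase (i := i) hj, incidenceSign_eq_erase (i := j) hi]
  rcases lt_or_gt_of_ne hij with h | h <;> simp [h, h.not_gt, mul_comm]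

theorem incidenceSign_insert_antisymm {i j : Fin q} {τ : Finset (Fin q)} (hi : i ∈ τ)
    (hj : j ∉ τ) :
    incidenceSign k j τ * incidenceSign k i (insert j τ) =
      -(incidenceSign k i τ * incidenceSign k j (τ.erase i)) := by
  have hij : i ≠ j := fun h => hj (h ▸ hi)
  rw [incidenceSign_insert hj, incidenceSign_eq_erase (i := j) hi]
  rcases lt_or_gt_of_ne hij with h | h <;> simp [h, h.not_gt, mul_comm]

/-- The direct sum of all the terms of the Taylor complex. -/
abbrev TaylorTotal (σ k : Type*) [Field k] (q : ℕ) : Type _ :=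
  Finset (Fin q) → MvPolynomial σ k

/-- The Taylor differential on the direct sum of all terms. -/
noncomputable def taylorTotalDifferential (k : Type*) [Field k] (a : Fin q → σ →₀ ℕ) :
    TaylorTotal σ k q →ₗ[MvPolynomial σ k] TaylorTotal σ k q :=
  Matrix.mulVecLin (Matrix.of fun τ' τ => taylorCoeff k a τ τ')

/-- The element `x^(u - m_τ) ε_τ`, of multidegree `u` if `m_τ` divides `x^u`. -/
noncomputable def taylorElement (k : Type*) [Field k] (a : Fin q → σ →₀ ℕ) (u : σ →₀ ℕ)
    (τ : Finset (Fin q)) : TaylorTotal σ k q :=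
  Pi.single τ (monomial (u - lcmExponent a τ) 1)

theorem taylorTotalDifferential_apply (a : Fin q → σ →₀ ℕ) (f : TaylorTotal σ k q)
    (τ' : Finset (Fin q)) :
    taylorTotalDifferential k a f τ' = ∑ τ, taylorCoeff k a τ τ' * f τ := rfl

theorem taylorTotalDifferential_taylorElement (a : Fin q → σ →₀ ℕ) {u : σ →₀ ℕ}
    {τ : Finset (Fin q)} (h : lcmExponent a τ ≤ u) :
    taylorTotalDifferential k a (taylorElement k a u τ) =
      ∑ j ∈ τ, incidenceSign k j τ • taylorElement k a u (τ.erase j) := by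
  funext τ'
  rw [taylorTotalDifferential_apply, Finset.sum_eq_single τ, Finset.sum_apply]
  · simp only [taylorCoeff, taylorElement, Pi.single_eq_same, Finset.sum_mul, Pi.smul_apply]
    refine Finset.sum_congr rfl fun j hj => ?_
    by_cases h' : τ' = τ.erase j
    · subst h'
      rw [if_pos rfl, Pi.single_eq_same, mul_assoc, monomial_mul, mul_one, incidenceSign,
        smul_eq_C_mul, map_pow, map_neg, C_1, add_comm,
        tsub_add_tsub_cancel h (lcmExponent_mono a (Finset.erase_subset _ _))]
    · rw [if_neg h', Pi.single_eq_of_ne h', zero_mul, smul_zero]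
  · intro τ'' _ hne
    simp [taylorElement, Pi.single_eq_of_ne hne]
  · simp

theorem lcmExponent_erase_le {a : Fin q → σ →₀ ℕ} {u : σ →₀ ℕ}
    {τ : Finset (Fin q)} (h : lcmExponent a τ ≤ u) (j : Fin q) : lcmExponent a (τ.erase j) ≤ u :=
  (lcmExponent_mono a (Finset.erase_subset _ _)).trans h

/-- The elements `x^(u - m_τ) ε_τ` with `m_τ ∣ x^u` form a `k`-basis of the total module. This
reduces identities to one multidegree, where the Taylor differential is a simplicial boundary. -/
theorem taylorTotal_ext_linear {N : Type*} [AddCommGroup N] [Module k N] (a : Fin q → σ →₀ ℕ)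
    {f g : TaylorTotal σ k q →ₗ[k] N}
    (h : ∀ u τ, lcmExponent a τ ≤ u → f (taylorElement k a u τ) = g (taylorElement k a u τ)) :
    f = g := by
  refine LinearMap.pi_ext' fun τ => ?_
  refine (basisMonomials σ k).ext fun v => ?_
  simpa [taylorElement] using h (v + lcmExponent a τ) τ le_add_self

theorem taylorTotalDifferential_comp_self (a : Fin q → σ →₀ ℕ) (f : TaylorTotal σ k q) :
    taylorTotalDifferential k a (taylorTotalDifferential k a f) = 0 := by
  have h : ((taylorTotalDifferential k a ∘ₗ taylorTotalDifferential k a).restrictScalars k) =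
      0 := by
    refine taylorTotal_ext_linear a fun u τ hu => ?_
    simp only [LinearMap.coe_restrictScalars, LinearMap.comp_apply, LinearMap.zero_apply]
    rw [taylorTotalDifferential_taylorElement a hu, map_sum]
    simp_rw [LinearMap.map_smul_of_tower]
    rw [Finset.sum_congr rfl fun i _ => by
      rw [taylorTotalDifferential_taylorElement a (lcmExponent_erase_le hu i), Finset.smul_sum],
      Finset.sum_sigma']
    -- Deleting `i` and then `j` cancels against deleting `j` and then `i`.
    refine Finset.sum_involution (fun p _ => ⟨p.2, p.1⟩) ?_ ?_ ?_ ?_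
    · rintro ⟨i, j⟩ hp
      simp only [Finset.mem_sigma, Finset.mem_erase] at hp
      simp only [smul_smul]
      rw [incidenceSign_erase_antisymm hp.1 hp.2.2 hp.2.1.symm, neg_smul, Finset.erase_right_comm,
        neg_add_cancel]
    · rintro ⟨i, j⟩ hp - heq
      simp only [Finset.mem_sigma, Finset.mem_erase] at hp
      exact hp.2.1 (congrArg Sigma.fst heq)
    · rintro ⟨i, j⟩ hp
      simp only [Finset.mem_sigma, Finset.mem_erase] at hp ⊢
      exact ⟨hp.2.2, hp.2.1.symm, hp.1⟩
    · rintro ⟨i, j⟩ hp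
      rfl
  exact LinearMap.congr_fun h f

/-- The operator that adds in multidegree `u` the vertex `c u` to each index set: a contracting
homotopy of the Taylor complex in the multidegrees `u` divisible by `m_{c u}`. -/
noncomputable def coneHomotopy (k : Type*) [Field k] (a : Fin q → σ →₀ ℕ)
    (c : (σ →₀ ℕ) → Fin q) : TaylorTotal σ k q →ₗ[k] TaylorTotal σ k q :=
  LinearMap.lsum k _ k fun τ => (basisMonomials σ k).constr k fun v =>
    -- The multidegree of `x^v ε_τ` is `v + m_τ`. The apex varies with it, so the operator is
    -- defined only as a `k`-linear map.
    if c (v + lcmExponent a τ) ∈ τ then 0 else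
      incidenceSign k (c (v + lcmExponent a τ)) τ •
        taylorElement k a (v + lcmExponent a τ) (insert (c (v + lcmExponent a τ)) τ)

theorem coneHomotopy_taylorElement (a : Fin q → σ →₀ ℕ) (c : (σ →₀ ℕ) → Fin q) {u : σ →₀ ℕ}
    {τ : Finset (Fin q)} (h : lcmExponent a τ ≤ u) :
    coneHomotopy k a c (taylorElement k a u τ) =
      if c u ∈ τ then 0 else incidenceSign k (c u) τ • taylorElement k a u (insert (c u) τ) := by
  have h1 : coneHomotopy k a c (taylorElement k a u τ) =
      (basisMonomials σ k).constr k (fun v =>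
    if c (v + lcmExponent a τ) ∈ τ then 0 else
      incidenceSign k (c (v + lcmExponent a τ)) τ •
        taylorElement k a (v + lcmExponent a τ) (insert (c (v + lcmExponent a τ)) τ))
      (basisMonomials σ k (u - lcmExponent a τ)) := by
    rw [coneHomotopy, taylorElement, LinearMap.lsum_piSingle, coe_basisMonomials]
  rw [h1, Module.Basis.constr_basis, tsub_add_cancel_of_le h]

theorem coneHomotopy_taylorElement_homotopy (a : Fin q → σ →₀ ℕ) {c : (σ →₀ ℕ) → Fin q}
    {u : σ →₀ ℕ} {τ : Finset (Fin q)} (h : lcmExponent a τ ≤ u) (hc : a (c u) ≤ u) :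
    taylorTotalDifferential k a (coneHomotopy k a c (taylorElement k a u τ)) +
      coneHomotopy k a c (taylorTotalDifferential k a (taylorElement k a u τ)) =
      taylorElement k a u τ := by
  rw [coneHomotopy_taylorElement a c h, taylorTotalDifferential_taylorElement a h, map_sum]
  simp_rw [map_smul]
  rw [Finset.sum_congr rfl fun j _ => by
    rw [coneHomotopy_taylorElement a c (lcmExponent_erase_le h j)]]
  -- If the apex lies in `τ`, only the face opposite to it contributes, and coning restores `τ`.
  -- Otherwise that face appears in the boundary of the cone, and the remaining terms cancel in
  -- pairs.
  by_cases hj : c u ∈ τ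
  · rw [if_pos hj, map_zero, zero_add, Finset.sum_eq_single (c u)]
    · rw [if_neg (Finset.notMem_erase _ _), Finset.insert_erase hj, smul_smul,
        incidenceSign_erase_self, incidenceSign_mul_self, one_smul]
    · intro i hi hne
      rw [if_pos (Finset.mem_erase.2 ⟨hne.symm, hj⟩), smul_zero]
    · exact fun h => (h hj).elim
  · have h' : lcmExponent a (insert (c u) τ) ≤ u := by
      rw [lcmExponent_le_iff] at h ⊢
      simpa [hc] using h
    rw [if_neg hj, LinearMap.map_smul_of_tower, taylorTotalDifferential_taylorElement a h',
      Finset.sum_insert hj, Finset.erase_insert hj, smul_add, smul_smul, incidenceSign_insert_self,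
      incidenceSign_mul_self, one_smul, add_assoc, Finset.smul_sum, ← Finset.sum_add_distrib,
      Finset.sum_eq_zero, add_zero]
    intro i hi
    have hij : i ≠ c u := fun h => hj (h ▸ hi)
    rw [if_neg (fun h => hj (Finset.mem_of_mem_erase h)), smul_smul, smul_smul,
      incidenceSign_insert_antisymm hi hj, Finset.erase_insert_of_ne hij.symm, neg_smul,
      neg_add_cancel]

/-- The predicate `P` keeps track of the support, so that the induction stays inside one term of a
subcomplex. -/
theorem taylorTotal_induction (a : Fin q → σ →₀ ℕ) (P : Finset (Fin q) → Prop)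
    {p : TaylorTotal σ k q → Prop} (zero : p 0) (add : ∀ f g, p f → p g → p (f + g))
    (smul : ∀ (c : k) f, p f → p (c • f))
    (elem : ∀ u τ, P τ → lcmExponent a τ ≤ u → p (taylorElement k a u τ))
    (f : TaylorTotal σ k q) (hf : ∀ τ, ¬ P τ → f τ = 0) : p f := by
  classical
  have hsum : ∀ (s : Finset (Finset (Fin q))) (g : Finset (Fin q) → TaylorTotal σ k q),
      (∀ τ ∈ s, p (g τ)) → p (∑ τ ∈ s, g τ) := fun s g hg =>
    Finset.sum_induction g p add zero hg
  rw [← Finset.univ_sum_single f]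
  refine hsum _ _ fun τ _ => ?_
  by_cases hτ : P τ
  · induction f τ using MvPolynomial.induction_on' with
    | monomial v b =>
      have := smul b _ (elem (v + lcmExponent a τ) τ hτ le_add_self)
      rwa [taylorElement, add_tsub_cancel_right, ← Pi.single_smul', smul_monomial, smul_eq_mul,
        mul_one] at this
    | add x y hx hy =>
      rw [Pi.single_add]
      exact add _ _ hx hy
  · rw [hf τ hτ, Pi.single_zero]
    exact zero

end TotalTaylor

/-! ### Subcomplexes of the Taylor complex: exactness and minimality. -/

section TaylorSubcomplex

open MvPolynomial

variable {σ k : Type*} [Field k] {q : ℕ}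

/-- Extension by zero from a term of `𝒯_Ω` to the direct sum of all terms of `𝒯`. -/
noncomputable def taylorExtend (Ω : Finset (Finset (Fin q))) (i : ℕ) :
    TaylorModule σ k Ω i →ₗ[MvPolynomial σ k] TaylorTotal σ k q where
  toFun f τ := if h : τ ∈ Ω ∧ τ.card = i then f ⟨τ, h⟩ else 0
  map_add' f g := by
    funext τ
    by_cases h : τ ∈ Ω ∧ τ.card = i <;> simp [h]
  map_smul' r f := by
    funext τ
    by_cases h : τ ∈ Ω ∧ τ.card = i <;> simp [h]

variable {Ω : Finset (Finset (Fin q))} {i : ℕ}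

theorem taylorExtend_apply (f : TaylorModule σ k Ω i) (τ : TaylorIndex Ω i) :
    taylorExtend Ω i f τ.1 = f τ := by
  simp [taylorExtend, τ.2]

theorem taylorExtend_apply_of_not (f : TaylorModule σ k Ω i) {τ : Finset (Fin q)}
    (h : ¬ (τ ∈ Ω ∧ τ.card = i)) : taylorExtend Ω i f τ = 0 := by
  simp [taylorExtend, h]

theorem taylorExtend_injective :
    Function.Injective (taylorExtend (σ := σ) (k := k) Ω i) := fun f g h => by
  funext τ
  rw [← taylorExtend_apply f, h, taylorExtend_apply]

theorem taylorExtend_restrict (f : TaylorTotal σ k q)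
    (h : ∀ τ, ¬ (τ ∈ Ω ∧ τ.card = i) → f τ = 0) :
    taylorExtend Ω i (fun τ => f τ.1) = f := by
  funext τ
  by_cases hτ : τ ∈ Ω ∧ τ.card = i
  · exact taylorExtend_apply (Ω := Ω) (i := i) (fun τ => f τ.1) ⟨τ, hτ⟩
  · rw [taylorExtend_apply_of_not _ hτ, h τ hτ]

theorem lcmExponent_empty (a : Fin q → σ →₀ ℕ) : lcmExponent a ∅ = 0 :=
  Finset.sup_empty.trans bot_eq_zero

theorem lcmExponent_singleton (a : Fin q → σ →₀ ℕ) (j : Fin q) : lcmExponent a {j} = a j :=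
  Finset.sup_singleton

theorem taylorCoeff_eq_zero {a : Fin q → σ →₀ ℕ} {τ τ' : Finset (Fin q)}
    (h : ∀ j ∈ τ, τ' ≠ τ.erase j) : taylorCoeff k a τ τ' = 0 :=
  Finset.sum_eq_zero fun j hj => if_neg (h j hj)

theorem taylorCoeff_erase (a : Fin q → σ →₀ ℕ) {τ : Finset (Fin q)} {j : Fin q} (hj : j ∈ τ) :
    taylorCoeff k a τ (τ.erase j) = (-1) ^ (τ.filter (· < j)).card *
      monomial (lcmExponent a τ - lcmExponent a (τ.erase j)) 1 := by
  rw [taylorCoeff, Finset.sum_eq_single j, if_pos rfl]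
  · intro i hi hne
    refine if_neg fun h => ?_
    have := Finset.notMem_erase i τ
    rw [← h] at this
    exact this (Finset.mem_erase.2 ⟨hne, hi⟩)
  · exact fun h => (h hj).elim

theorem sum_taylorCoeff_mul_taylorExtend (a : Fin q → σ →₀ ℕ) (f : TaylorModule σ k Ω i)
    (τ' : Finset (Fin q)) :
    ∑ τ, taylorCoeff k a τ τ' * taylorExtend Ω i f τ =
      ∑ τ : TaylorIndex Ω i, taylorCoeff k a τ.1 τ' * f τ := by
  rw [← Finset.sum_subset (Finset.subset_univ (Finset.univ.filter fun τ => τ ∈ Ω ∧ τ.card = i))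
    fun τ _ hτ => by rw [taylorExtend_apply_of_not _ (by simpa using hτ), mul_zero]]
  rw [Finset.sum_subtype (p := fun τ => τ ∈ Ω ∧ τ.card = i) _ (by simp)]
  exact Finset.sum_congr rfl fun τ _ => by rw [taylorExtend_apply]

/-- Closure of `Ω` under subsets guarantees that no face is lost when the differential is
restricted. -/
theorem taylorTotalDifferential_taylorExtend (hΩ : IsLowerSet (Ω : Set (Finset (Fin q))))
    (a : Fin q → σ →₀ ℕ) (f : TaylorModule σ k Ω (i + 1)) :
    taylorTotalDifferential k a (taylorExtend Ω (i + 1) f) =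
      taylorExtend Ω i (taylorDifferential k a Ω i f) := by
  funext τ'
  rw [taylorTotalDifferential_apply, sum_taylorCoeff_mul_taylorExtend]
  by_cases hτ' : τ' ∈ Ω ∧ τ'.card = i
  · rw [taylorExtend_apply (taylorDifferential k a Ω i f) ⟨τ', hτ'⟩]
    rfl
  · rw [taylorExtend_apply_of_not _ hτ']
    refine Finset.sum_eq_zero fun τ _ => ?_
    rw [taylorCoeff_eq_zero, zero_mul]
    rintro j hj rfl
    refine hτ' ⟨hΩ (Finset.erase_subset _ _) τ.2.1, ?_⟩
    rw [Finset.card_erase_of_mem hj, τ.2.2, Nat.add_sub_cancel]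

/-- The condition on `Ω` that makes `𝒯_Ω` a resolution: in each multidegree `u` divisible by some
`m_j`, the index sets `τ ∈ Ω` with `m_τ ∣ x^u` form a cone. -/
def IsConical (a : Fin q → σ →₀ ℕ) (Ω : Finset (Finset (Fin q))) : Prop :=
  ∀ u : σ →₀ ℕ, (∃ j, a j ≤ u) →
    ∃ j, a j ≤ u ∧ ∀ τ ∈ Ω, lcmExponent a τ ≤ u → insert j τ ∈ Ω

theorem coneHomotopy_spec {a : Fin q → σ →₀ ℕ} {c : (σ →₀ ℕ) → Fin q}
    (hc : ∀ u, (∃ j, a j ≤ u) →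
      a (c u) ≤ u ∧ ∀ τ ∈ Ω, lcmExponent a τ ≤ u → insert (c u) τ ∈ Ω)
    (f : TaylorTotal σ k q) (hf : ∀ τ, ¬ (τ ∈ Ω ∧ τ.card = i + 1) → f τ = 0) :
    (taylorTotalDifferential k a (coneHomotopy k a c f) +
      coneHomotopy k a c (taylorTotalDifferential k a f) = f) ∧
    ∀ τ, ¬ (τ ∈ Ω ∧ τ.card = i + 1 + 1) → coneHomotopy k a c f τ = 0 := by
  refine taylorTotal_induction a (fun τ => τ ∈ Ω ∧ τ.card = i + 1)
    (p := fun f => (taylorTotalDifferential k a (coneHomotopy k a c f) +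
      coneHomotopy k a c (taylorTotalDifferential k a f) = f) ∧
      ∀ τ, ¬ (τ ∈ Ω ∧ τ.card = i + 1 + 1) → coneHomotopy k a c f τ = 0) ?_ ?_ ?_ ?_ f hf
  · simp
  · rintro f g ⟨hf, hf'⟩ ⟨hg, hg'⟩
    refine ⟨?_, fun τ hτ => ?_⟩
    · simp only [map_add]
      rw [add_add_add_comm, hf, hg]
    · rw [map_add, Pi.add_apply, hf' τ hτ, hg' τ hτ, add_zero]
  · rintro r f ⟨hf, hf'⟩
    refine ⟨?_, fun τ hτ => ?_⟩
    · simp only [map_smul, LinearMap.map_smul_of_tower]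
      rw [← smul_add, hf]
    · rw [map_smul, Pi.smul_apply, hf' τ hτ, smul_zero]
  · rintro u τ ⟨hτ, hcard⟩ hu
    -- Positive degree enters here: a nonempty `τ` supplies a generator dividing `x^u`, hence an
    -- apex.
    obtain ⟨j, hj⟩ : τ.Nonempty := Finset.card_pos.1 (by omega)
    obtain ⟨hcu, hcu'⟩ := hc u ⟨j, (lcmExponent_le_iff.1 hu) j hj⟩
    refine ⟨coneHomotopy_taylorElement_homotopy a hu hcu, fun τ' hτ' => ?_⟩
    rw [coneHomotopy_taylorElement a c hu]
    split_ifs with hmem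
    · rfl
    · rw [Pi.smul_apply, taylorElement, Pi.single_eq_of_ne, smul_zero]
      rintro rfl
      exact hτ' ⟨hcu' τ hτ hu, by rw [Finset.card_insert_of_notMem hmem, hcard]⟩

theorem taylorDifferential_exact {a : Fin q → σ →₀ ℕ}
    (hΩ : IsLowerSet (Ω : Set (Finset (Fin q)))) (hcone : IsConical a Ω) (i : ℕ) :
    Function.Exact (taylorDifferential k a Ω (i + 1)) (taylorDifferential k a Ω i) := by
  intro f
  constructor
  · intro hf
    rcases isEmpty_or_nonempty (Fin q) with hq | ⟨⟨j₀⟩⟩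
    · have : IsEmpty (TaylorIndex Ω (i + 1)) := ⟨fun τ => by
        have h1 := τ.2.2
        rw [Finset.eq_empty_of_isEmpty τ.1] at h1
        simp at h1⟩
      exact ⟨0, Subsingleton.elim _ _⟩
    -- The index `j₀` is a default apex for multidegrees divisible by no generator.
    · have : ∀ u, ∃ j, (∃ j, a j ≤ u) →
          a j ≤ u ∧ ∀ τ ∈ Ω, lcmExponent a τ ≤ u → insert j τ ∈ Ω := fun u => by
        by_cases hu : ∃ j, a j ≤ u
        · obtain ⟨j, hj⟩ := hcone u hu
          exact ⟨j, fun _ => hj⟩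
        · exact ⟨j₀, fun h => (hu h).elim⟩
      choose c hc using this
      obtain ⟨h1, h2⟩ := coneHomotopy_spec hc (taylorExtend Ω (i + 1) f)
        fun τ hτ => taylorExtend_apply_of_not f hτ
      rw [taylorTotalDifferential_taylorExtend hΩ, hf, map_zero, map_zero, add_zero] at h1
      refine ⟨fun τ => coneHomotopy k a c (taylorExtend Ω (i + 1) f) τ.1, ?_⟩
      apply taylorExtend_injective
      rw [← taylorTotalDifferential_taylorExtend hΩ, taylorExtend_restrict _ h2, h1]
  · rintro ⟨g, rfl⟩
    apply taylorExtend_injective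
    rw [← taylorTotalDifferential_taylorExtend hΩ, ← taylorTotalDifferential_taylorExtend hΩ,
      taylorTotalDifferential_comp_self, map_zero]

theorem taylor_isFreeResolution {I : Ideal (MvPolynomial σ k)} {a : Fin q → σ →₀ ℕ}
    (hI : I = Ideal.span (Set.range fun j => monomial (a j) (1 : k)))
    (hΩ : IsLowerSet (Ω : Set (Finset (Fin q)))) (hcone : IsConical a Ω)
    (h0 : ∅ ∈ Ω) (h1 : ∀ j, {j} ∈ Ω) :
    IsFreeResolution (MvPolynomial σ k ⧸ I) (TaylorModule σ k Ω) (taylorDifferential k a Ω) := by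
  refine ⟨fun _ => inferInstance, fun _ => inferInstance, taylorDifferential_exact hΩ hcone, ⟨?_⟩⟩
  let _ : Unique (TaylorIndex Ω 0) :=
    ⟨⟨⟨∅, h0, rfl⟩⟩, fun τ => Subtype.ext (Finset.card_eq_zero.1 τ.2.2)⟩
  refine Submodule.Quotient.equiv _ _
    (LinearEquiv.funUnique (TaylorIndex Ω 0) (MvPolynomial σ k) (MvPolynomial σ k)) ?_
  have hd : ∀ f : TaylorModule σ k Ω 1,
      LinearEquiv.funUnique (TaylorIndex Ω 0) (MvPolynomial σ k) (MvPolynomial σ k)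
        (taylorDifferential k a Ω 0 f) = ∑ τ : TaylorIndex Ω 1, taylorCoeff k a τ.1 ∅ * f τ :=
    fun f => rfl
  have hs : ∀ j, taylorCoeff k a {j} ∅ = monomial (a j) 1 := fun j => by
    have := taylorCoeff_erase (k := k) a (Finset.mem_singleton_self j)
    rw [Finset.erase_singleton, Finset.filter_singleton, if_neg (lt_irrefl j),
      lcmExponent_empty, lcmExponent_singleton] at this
    simpa using this
  apply le_antisymm
  · rintro _ ⟨_, ⟨f, rfl⟩, rfl⟩
    change ∑ τ : TaylorIndex Ω 1, taylorCoeff k a τ.1 ∅ * f τ ∈ I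
    refine hI ▸ Ideal.sum_mem _ fun τ _ => Ideal.mul_mem_right _ _ ?_
    obtain ⟨j, hj⟩ := Finset.card_eq_one.1 τ.2.2
    rw [hj, hs]
    exact Ideal.subset_span ⟨j, rfl⟩
  · refine hI ▸ Submodule.span_le.2 ?_
    rintro _ ⟨j, rfl⟩
    refine ⟨_, ⟨Pi.single ⟨{j}, h1 j, rfl⟩ 1, rfl⟩, ?_⟩
    refine (hd _).trans ?_
    rw [Finset.sum_eq_single ⟨{j}, h1 j, rfl⟩]
    · simp [hs]
    · intro τ _ hne
      rw [Pi.single_eq_of_ne hne, mul_zero]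
    · simp

theorem isLowerSet_coe_univ :
    IsLowerSet ((Finset.univ : Finset (Finset (Fin q))) : Set (Finset (Fin q))) :=
  fun _ _ _ _ => Finset.mem_coe.2 (Finset.mem_univ _)

theorem isConical_univ (a : Fin q → σ →₀ ℕ) : IsConical a Finset.univ :=
  fun _ ⟨j, hj⟩ => ⟨j, hj, fun _ _ _ => Finset.mem_univ _⟩

theorem taylor_univ_isFreeResolution {I : Ideal (MvPolynomial σ k)} {a : Fin q → σ →₀ ℕ}
    (hI : I = Ideal.span (Set.range fun j => monomial (a j) (1 : k))) :
    IsFreeResolution (MvPolynomial σ k ⧸ I) (TaylorModule σ k (Finset.univ))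
      (taylorDifferential k a Finset.univ) :=
  taylor_isFreeResolution hI isLowerSet_coe_univ (isConical_univ a) (Finset.mem_univ _)
    fun _ => Finset.mem_univ _

theorem mem_irrelevantIdeal_iff (p : MvPolynomial σ k) :
    p ∈ irrelevantIdeal σ k ↔ constantCoeff p = 0 := by
  rw [irrelevantIdeal, ← Set.image_univ, mem_ideal_span_X_image]
  constructor
  · intro h
    by_contra h0
    obtain ⟨i, -, hi⟩ := h 0 (mem_support_iff.2 h0)
    exact hi rfl
  · intro h m hm
    by_contra! hne
    have : m = 0 := Finsupp.ext fun i => hne i (Set.mem_univ i)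
    subst this
    exact mem_support_iff.1 hm h

instance irrelevantIdeal_isMaximal : (irrelevantIdeal σ k).IsMaximal := by
  have h : irrelevantIdeal σ k = RingHom.ker (constantCoeff (R := k) (σ := σ)) := by
    ext p
    rw [mem_irrelevantIdeal_iff, RingHom.mem_ker]
  rw [h]
  exact RingHom.ker_isMaximal_of_surjective _ fun r => ⟨C r, constantCoeff_C _ r⟩

theorem Ideal.mem_smul_top_pi_iff {R ι : Type*} [CommRing R] [Finite ι] (J : Ideal R)
    (x : ι → R) : x ∈ J • (⊤ : Submodule R (ι → R)) ↔ ∀ i, x i ∈ J := by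
  classical
  have := Fintype.ofFinite ι
  constructor
  · intro h
    refine Submodule.smul_induction_on h (fun r hr y _ i => ?_) fun y z hy hz i => ?_
    · exact J.mul_mem_right _ hr
    · exact J.add_mem (hy i) (hz i)
  · intro h
    rw [pi_eq_sum_univ' x]
    exact Submodule.sum_mem _ fun i _ => Submodule.smul_mem_smul (h i) trivial

/-- The coefficient is a signed monomial, hence a unit exactly when its exponent vanishes.
Minimality of a subcomplex thus becomes a condition on lcms. -/
theorem taylorCoeff_erase_mem_iff (a : Fin q → σ →₀ ℕ) {τ : Finset (Fin q)} {j : Fin q}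
    (hj : j ∈ τ) : taylorCoeff k a τ (τ.erase j) ∈ irrelevantIdeal σ k ↔
      lcmExponent a (τ.erase j) ≠ lcmExponent a τ := by
  classical
  have h : lcmExponent a (τ.erase j) = lcmExponent a τ ↔
      lcmExponent a τ ≤ lcmExponent a (τ.erase j) :=
    ⟨fun h => h.ge, (lcmExponent_mono a (Finset.erase_subset j τ)).antisymm⟩
  rw [mem_irrelevantIdeal_iff, taylorCoeff_erase a hj, map_mul, map_pow, map_neg, map_one,
    constantCoeff_monomial, Ne, h, ← tsub_eq_zero_iff_le]
  simp

theorem taylorDifferential_single (a : Fin q → σ →₀ ℕ) (τ : TaylorIndex Ω (i + 1))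
    (τ' : TaylorIndex Ω i) :
    taylorDifferential k a Ω i (Pi.single τ 1) τ' = taylorCoeff k a τ.1 τ'.1 := by
  simp [taylorDifferential]

theorem range_taylorDifferential_le_iff (hΩ : IsLowerSet (Ω : Set (Finset (Fin q))))
    (a : Fin q → σ →₀ ℕ) :
    (∀ i, LinearMap.range (taylorDifferential k a Ω i) ≤
      irrelevantIdeal σ k • (⊤ : Submodule _ (TaylorModule σ k Ω i))) ↔
    ∀ τ ∈ Ω, ∀ j ∈ τ, lcmExponent a (τ.erase j) ≠ lcmExponent a τ := by
  constructor
  · intro h τ hτ j hj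
    obtain ⟨i, hi⟩ : ∃ i, τ.card = i + 1 :=
      Nat.exists_eq_succ_of_ne_zero (Finset.card_ne_zero_of_mem hj)
    have h1 := (Ideal.mem_smul_top_pi_iff _ _).1 (h i ⟨Pi.single ⟨τ, hτ, hi⟩ 1, rfl⟩)
      ⟨τ.erase j, hΩ (Finset.erase_subset j τ) hτ, by rw [Finset.card_erase_of_mem hj, hi]; rfl⟩
    rwa [taylorDifferential_single, taylorCoeff_erase_mem_iff a hj] at h1
  · rintro h i _ ⟨f, rfl⟩
    refine (Ideal.mem_smul_top_pi_iff _ _).2 fun τ' => ?_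
    change ∑ τ : TaylorIndex Ω (i + 1), taylorCoeff k a τ.1 τ'.1 * f τ ∈ _
    refine Ideal.sum_mem _ fun τ _ => Ideal.mul_mem_right _ _ ?_
    by_cases hj : ∃ j ∈ τ.1, τ'.1 = τ.1.erase j
    · obtain ⟨j, hj, hj'⟩ := hj
      rw [hj', taylorCoeff_erase_mem_iff a hj]
      exact h τ.1 τ.2.1 j hj
    · push Not at hj
      rw [taylorCoeff_eq_zero hj]
      exact zero_mem _

end TaylorSubcomplex

/-! ### Existence of a minimal resolution by cancelling units. -/

section MinimalResolution

open MvPolynomial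

variable {σ k : Type*} [Field k] {q : ℕ}

/-- The elements of the direct sum of all terms of the Taylor complex that are supported on the
index sets of cardinality `i` in `Ω`. -/
def taylorSupported (σ k : Type*) [Field k] (Ω : Finset (Finset (Fin q))) (i : ℕ) :
    Submodule (MvPolynomial σ k) (TaylorTotal σ k q) where
  carrier := {f | ∀ τ, ¬ (τ ∈ Ω ∧ τ.card = i) → f τ = 0}
  add_mem' hf hg τ hτ := by rw [Pi.add_apply, hf τ hτ, hg τ hτ, add_zero]
  zero_mem' _ _ := rfl
  smul_mem' r f hf τ hτ := by rw [Pi.smul_apply, hf τ hτ, smul_zero]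

/-- The homogeneous endomorphism of the direct sum of all terms of the Taylor complex with the
scalar coefficients `c`. -/
noncomputable def scalarDifferential (a : Fin q → σ →₀ ℕ)
    (c : Finset (Fin q) → Finset (Fin q) → k) :
    TaylorTotal σ k q →ₗ[MvPolynomial σ k] TaylorTotal σ k q :=
  Matrix.mulVecLin (Matrix.of fun τ' τ => monomial (lcmExponent a τ - lcmExponent a τ') (c τ' τ))

variable {a : Fin q → σ →₀ ℕ} {c : Finset (Fin q) → Finset (Fin q) → k}

theorem scalarDifferential_apply (f : TaylorTotal σ k q) (τ' : Finset (Fin q)) :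
    scalarDifferential a c f τ' =
      ∑ τ, monomial (lcmExponent a τ - lcmExponent a τ') (c τ' τ) * f τ := rfl

theorem scalarDifferential_single (τ τ' : Finset (Fin q)) :
    scalarDifferential a c (Pi.single τ 1) τ' =
      monomial (lcmExponent a τ - lcmExponent a τ') (c τ' τ) := by
  simp [scalarDifferential]

/-- The coefficients `c` define a multigraded free resolution of `Q/I` with basis `Ω`, homologically
graded by cardinality and with multidegrees given by the `m_τ`. -/
structure IsScalarResolution (I : Ideal (MvPolynomial σ k)) (a : Fin q → σ →₀ ℕ)
    (Ω : Finset (Finset (Fin q))) (c : Finset (Fin q) → Finset (Fin q) → k) : Prop where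
  mem : ∀ {τ' τ}, c τ' τ ≠ 0 → τ' ∈ Ω ∧ τ ∈ Ω
  card : ∀ {τ' τ}, c τ' τ ≠ 0 → τ.card = τ'.card + 1
  le : ∀ {τ' τ}, c τ' τ ≠ 0 → lcmExponent a τ' ≤ lcmExponent a τ
  comp_self : ∀ f, scalarDifferential a c (scalarDifferential a c f) = 0
  exact : ∀ i, ∀ f ∈ taylorSupported σ k Ω (i + 1), scalarDifferential a c f = 0 →
    ∃ g ∈ taylorSupported σ k Ω (i + 2), scalarDifferential a c g = f
  augmentation : ∃ ε : TaylorTotal σ k q →ₗ[MvPolynomial σ k] MvPolynomial σ k ⧸ I,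
    (∀ x, ∃ f ∈ taylorSupported σ k Ω 0, ε f = x) ∧
    ∀ f ∈ taylorSupported σ k Ω 0,
      (ε f = 0 ↔ ∃ g ∈ taylorSupported σ k Ω 1, scalarDifferential a c g = f)

namespace IsScalarResolution

variable {I : Ideal (MvPolynomial σ k)} {Ω : Finset (Finset (Fin q))}
  (h : IsScalarResolution I a Ω c)

include h

theorem apply_eq_zero {i : ℕ} {f : TaylorTotal σ k q} (hf : f ∈ taylorSupported σ k Ω i)
    {τ' : Finset (Fin q)} (hτ' : ¬ (τ' ∈ Ω ∧ τ'.card + 1 = i)) :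
    scalarDifferential a c f τ' = 0 := by
  rw [scalarDifferential_apply]
  refine Finset.sum_eq_zero fun τ _ => ?_
  by_cases hc : c τ' τ = 0
  · rw [hc, monomial_zero, zero_mul]
  · rw [hf τ, mul_zero]
    rintro ⟨-, hi⟩
    exact hτ' ⟨(h.mem hc).1, by rw [← h.card hc, hi]⟩

theorem map_mem {i : ℕ} {f : TaylorTotal σ k q} (hf : f ∈ taylorSupported σ k Ω (i + 1)) :
    scalarDifferential a c f ∈ taylorSupported σ k Ω i := fun _ hτ =>
  h.apply_eq_zero hf fun hτ' => hτ ⟨hτ'.1, Nat.succ_injective hτ'.2⟩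

theorem map_eq_zero {f : TaylorTotal σ k q} (hf : f ∈ taylorSupported σ k Ω 0) :
    scalarDifferential a c f = 0 :=
  funext fun _ => h.apply_eq_zero hf fun hτ' => Nat.succ_ne_zero _ hτ'.2

omit h in
theorem single_mem {τ : Finset (Fin q)} (hτ : τ ∈ Ω) {i : ℕ} (hi : τ.card = i)
    (r : MvPolynomial σ k) :
    r • (Pi.single τ 1 : TaylorTotal σ k q) ∈ taylorSupported σ k Ω i := fun τ' hτ' => by
  rw [Pi.smul_apply, Pi.single_eq_of_ne, smul_zero]
  rintro rfl
  exact hτ' ⟨hτ, hi⟩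

/-- A multigraded resolution without units among its coefficients is minimal. -/
theorem exists_isMinimalFreeResolution
    (hmin : ∀ τ' τ, c τ' τ ≠ 0 → lcmExponent a τ' ≠ lcmExponent a τ) :
    ∃ d, IsMinimalFreeResolution (irrelevantIdeal σ k) (MvPolynomial σ k ⧸ I)
      (TaylorModule σ k Ω) d := by
  let d : ∀ i, TaylorModule σ k Ω (i + 1) →ₗ[MvPolynomial σ k] TaylorModule σ k Ω i := fun i =>
    LinearMap.funLeft _ _ Subtype.val ∘ₗ scalarDifferential a c ∘ₗ taylorExtend Ω (i + 1)
  have hE : ∀ i (f : TaylorModule σ k Ω i), taylorExtend Ω i f ∈ taylorSupported σ k Ω i :=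
    fun i f τ hτ => taylorExtend_apply_of_not f hτ
  have hd : ∀ i f, taylorExtend Ω i (d i f) = scalarDifferential a c (taylorExtend Ω (i + 1) f) :=
    fun i f => taylorExtend_restrict _ (h.map_mem (hE _ f))
  have hR : ∀ i, ∀ f ∈ taylorSupported σ k Ω i,
      ∃ f' : TaylorModule σ k Ω i, taylorExtend Ω i f' = f :=
    fun i f hf => ⟨_, taylorExtend_restrict f hf⟩
  refine ⟨d, ⟨fun _ => inferInstance, fun _ => inferInstance, fun i f => ⟨fun hf => ?_, ?_⟩, ?_⟩,
    ?_⟩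
  · obtain ⟨g, hg, hgf⟩ := h.exact i _ (hE _ f) (by rw [← hd, hf, map_zero])
    obtain ⟨g, rfl⟩ := hR _ g hg
    exact ⟨g, taylorExtend_injective (by rw [hd, hgf])⟩
  · rintro ⟨g, rfl⟩
    apply taylorExtend_injective
    rw [hd, hd, h.comp_self, map_zero]
  · obtain ⟨ε, hε, hε'⟩ := h.augmentation
    have hsurj : Function.Surjective (ε ∘ₗ taylorExtend Ω 0) := fun x => by
      obtain ⟨f, hf, hx⟩ := hε x
      obtain ⟨f, rfl⟩ := hR _ f hf
      exact ⟨f, hx⟩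
    refine ⟨(Submodule.quotEquivOfEq _ _ ?_).trans
      ((ε ∘ₗ taylorExtend Ω 0).quotKerEquivOfSurjective hsurj)⟩
    ext f
    rw [LinearMap.mem_ker, LinearMap.comp_apply, hε' _ (hE 0 f)]
    constructor
    · rintro ⟨g, rfl⟩
      exact ⟨_, hE 1 g, (hd 0 g).symm⟩
    · rintro ⟨g, hg, hgf⟩
      obtain ⟨g, rfl⟩ := hR _ g hg
      exact ⟨g, taylorExtend_injective (by rw [hd, hgf])⟩
  · rintro i _ ⟨f, rfl⟩
    refine (Ideal.mem_smul_top_pi_iff _ _).2 fun τ' => ?_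
    change ∑ τ, monomial (lcmExponent a τ - lcmExponent a τ'.1) (c τ'.1 τ) *
      taylorExtend Ω (i + 1) f τ ∈ _
    refine Ideal.sum_mem _ fun τ _ => Ideal.mul_mem_right _ _ ?_
    classical
    rw [mem_irrelevantIdeal_iff, constantCoeff_monomial]
    split_ifs with h0
    · by_contra hc
      exact hmin _ _ hc ((h.le hc).antisymm (tsub_eq_zero_iff_le.1 h0))
    · rfl

end IsScalarResolution

/-- The coefficients after cancelling the basis elements `b` and `b'`. -/
def cancelCoeff (Ω : Finset (Finset (Fin q))) (c : Finset (Fin q) → Finset (Fin q) → k)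
    (b' b τ' τ : Finset (Fin q)) : k :=
  if τ' ∈ (Ω.erase b).erase b' ∧ τ ∈ (Ω.erase b).erase b' then
    c τ' τ - c τ' b * (c b' b)⁻¹ * c b' τ
  else 0

/-- The embedding of the complex after cancelling `b` and `b'` into the original one. -/
noncomputable def cancelEmbedding (a : Fin q → σ →₀ ℕ) (c : Finset (Fin q) → Finset (Fin q) → k)
    (b' b : Finset (Fin q)) (f : TaylorTotal σ k q) : TaylorTotal σ k q :=
  f - (C (c b' b)⁻¹ * scalarDifferential a c f b') • (Pi.single b 1 : TaylorTotal σ k q)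

namespace IsScalarResolution

variable {I : Ideal (MvPolynomial σ k)} {Ω : Finset (Finset (Fin q))}
  (h : IsScalarResolution I a Ω c) {b' b : Finset (Fin q)} (hb : c b' b ≠ 0)
  (hbb : lcmExponent a b' = lcmExponent a b)

include h hb hbb

omit hb in
-- The correction term in `cancelCoeff` is the Schur complement of Gaussian elimination: the
-- contribution of the multiple of `ε_b` that `cancelEmbedding` subtracts.
theorem scalarDifferential_cancelCoeff {f : TaylorTotal σ k q}
    (hf : ∀ τ ∉ (Ω.erase b).erase b', f τ = 0) {τ' : Finset (Fin q)}
    (hτ' : τ' ∈ (Ω.erase b).erase b') :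
    scalarDifferential a (cancelCoeff Ω c b' b) f τ' =
      scalarDifferential a c (cancelEmbedding a c b' b f) τ' := by
  rw [cancelEmbedding, map_sub, map_smul, Pi.sub_apply, Pi.smul_apply, scalarDifferential_single,
    scalarDifferential_apply, scalarDifferential_apply, scalarDifferential_apply, smul_eq_mul,
    Finset.mul_sum, Finset.sum_mul, ← Finset.sum_sub_distrib]
  refine Finset.sum_congr rfl fun τ _ => ?_
  by_cases hτ : τ ∈ (Ω.erase b).erase b'
  · rw [cancelCoeff, if_pos ⟨hτ', hτ⟩, map_sub, sub_mul]
    congr 1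
    by_cases h1 : c τ' b = 0
    · simp [h1]
    by_cases h2 : c b' τ = 0
    · simp [h2]
    -- Since `m_b = m_b'`, the monomial from `τ` to `τ'` factors through this common multidegree.
    rw [← tsub_add_tsub_cancel ((h.le h2).trans' hbb.ge) (h.le h1), ← hbb]
    have : monomial (lcmExponent a τ - lcmExponent a b' + (lcmExponent a b' - lcmExponent a τ'))
        (c τ' b * (c b' b)⁻¹ * c b' τ) = C (c b' b)⁻¹ *
        monomial (lcmExponent a τ - lcmExponent a b') (c b' τ) *
          monomial (lcmExponent a b' - lcmExponent a τ') (c τ' b) := by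
      rw [C_mul_monomial, monomial_mul]
      congr 1
      ring
    rw [this]
    ring
  · rw [hf τ hτ]
    ring

omit h hb in
theorem scalarDifferential_smul_single (r : MvPolynomial σ k) :
    scalarDifferential a c (r • Pi.single b 1) b' = r * C (c b' b) := by
  rw [map_smul, Pi.smul_apply, scalarDifferential_single, hbb, tsub_self, smul_eq_mul]
  rfl

omit h hbb in
theorem C_inv_mul_C : (C (c b' b)⁻¹ * C (c b' b) : MvPolynomial σ k) = 1 := by
  rw [← C_mul, inv_mul_cancel₀ hb, C_1]

omit h in
-- The multiple of `ε_b` in `cancelEmbedding` is chosen precisely for this vanishing.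
theorem scalarDifferential_cancelEmbedding_apply (f : TaylorTotal σ k q) :
    scalarDifferential a c (cancelEmbedding a c b' b f) b' = 0 := by
  rw [cancelEmbedding, map_sub, Pi.sub_apply, scalarDifferential_smul_single hbb,
    mul_right_comm, C_inv_mul_C hb, one_mul, sub_self]

omit h hb hbb in
theorem cancelCoeff_apply_eq_zero (f : TaylorTotal σ k q) {τ' : Finset (Fin q)}
    (hτ' : τ' ∉ (Ω.erase b).erase b') :
    scalarDifferential a (cancelCoeff Ω c b' b) f τ' = 0 := by
  rw [scalarDifferential_apply]
  refine Finset.sum_eq_zero fun τ _ => ?_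
  rw [cancelCoeff, if_neg fun h => hτ' h.1, monomial_zero, zero_mul]

omit hbb in
theorem ne_of_coeff_ne_zero : b ≠ b' := fun h' => by
  have := h.card hb
  rw [h'] at this
  omega

theorem scalarDifferential_cancelEmbedding {f : TaylorTotal σ k q}
    (hf : ∀ τ ∉ (Ω.erase b).erase b', f τ = 0) :
    scalarDifferential a c (cancelEmbedding a c b' b f) =
      cancelEmbedding a c b' b (scalarDifferential a (cancelCoeff Ω c b' b) f) := by
  set w := scalarDifferential a (cancelCoeff Ω c b' b) f with hw
  set g := cancelEmbedding a c b' b f with hg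
  have hne := h.ne_of_coeff_ne_zero hb
  -- The two sides of the claim can differ only in the `b` coordinate; reading `D² g = 0` at `b'`
  -- then determines that coordinate.
  have h1 : scalarDifferential a c g = w + scalarDifferential a c g b • Pi.single b 1 := by
    funext τ'
    rw [Pi.add_apply, Pi.smul_apply]
    by_cases hτ' : τ' ∈ (Ω.erase b).erase b'
    · have : τ' ≠ b := (Finset.mem_erase.1 (Finset.mem_erase.1 hτ').2).1
      rw [Pi.single_eq_of_ne this, smul_zero, add_zero, hw,
        h.scalarDifferential_cancelCoeff hbb hf hτ']
    · rw [hw, cancelCoeff_apply_eq_zero f hτ', zero_add]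
      by_cases hτb : τ' = b
      · rw [hτb, Pi.single_eq_same, smul_eq_mul, mul_one]
      · rw [Pi.single_eq_of_ne hτb, smul_zero]
        by_cases hτb' : τ' = b'
        · rw [hτb', hg, scalarDifferential_cancelEmbedding_apply hb hbb]
        · rw [scalarDifferential_apply]
          refine Finset.sum_eq_zero fun τ _ => ?_
          by_cases hc : c τ' τ = 0
          · rw [hc, monomial_zero, zero_mul]
          · exact (hτ' (Finset.mem_erase.2 ⟨hτb', Finset.mem_erase.2 ⟨hτb, (h.mem hc).1⟩⟩)).elim
  have h2 := congrFun (h.comp_self g) b'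
  rw [h1, map_add, Pi.add_apply, scalarDifferential_smul_single hbb, Pi.zero_apply] at h2
  have h3 : scalarDifferential a c g b = -(C (c b' b)⁻¹ * scalarDifferential a c w b') := by
    rw [eq_neg_of_add_eq_zero_left h2, mul_neg, neg_neg, mul_left_comm, C_inv_mul_C hb, mul_one]
  rw [h1, h3, neg_smul, ← sub_eq_add_neg]
  rfl

omit h hb hbb in
theorem eq_of_cancelEmbedding_eq {f g : TaylorTotal σ k q}
    (hf : ∀ τ ∉ (Ω.erase b).erase b', f τ = 0) (hg : ∀ τ ∉ (Ω.erase b).erase b', g τ = 0)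
    (heq : cancelEmbedding a c b' b f = cancelEmbedding a c b' b g) : f = g := by
  funext τ
  by_cases hτ : τ = b
  · rw [hf, hg] <;> simp [hτ]
  · simpa [cancelEmbedding, hτ] using congrFun heq τ

omit hbb in
theorem cancelEmbedding_mem {i : ℕ} {f : TaylorTotal σ k q}
    (hf : f ∈ taylorSupported σ k Ω i) : cancelEmbedding a c b' b f ∈ taylorSupported σ k Ω i := by
  refine sub_mem hf ?_
  by_cases hi : b.card = i
  · exact single_mem (h.mem hb).2 hi _
  · rw [h.apply_eq_zero hf fun h' => hi (by rw [h.card hb, h'.2]), mul_zero, zero_smul]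
    exact zero_mem _

omit h hb hbb in
theorem taylorSupported_cancel_le (i : ℕ) :
    taylorSupported σ k ((Ω.erase b).erase b') i ≤ taylorSupported σ k Ω i := fun _ hf τ hτ =>
  hf τ fun h => hτ ⟨Finset.mem_of_mem_erase (Finset.mem_of_mem_erase h.1), h.2⟩

omit h hb hbb in
theorem eq_zero_of_mem_taylorSupported {Ω : Finset (Finset (Fin q))} {i : ℕ}
    {f : TaylorTotal σ k q} (hf : f ∈ taylorSupported σ k Ω i) :
    ∀ τ ∉ Ω, f τ = 0 := fun τ hτ => hf τ fun h => hτ h.1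

omit h hb hbb in
theorem mem_taylorSupported_cancel {i : ℕ} {f : TaylorTotal σ k q}
    (hf : f ∈ taylorSupported σ k Ω i) (h1 : f b = 0) (h2 : f b' = 0) :
    f ∈ taylorSupported σ k ((Ω.erase b).erase b') i := fun τ hτ => by
  by_cases hτb : τ = b
  · rw [hτb, h1]
  by_cases hτb' : τ = b'
  · rw [hτb', h2]
  · exact hf τ fun h => hτ ⟨Finset.mem_erase.2 ⟨hτb', Finset.mem_erase.2 ⟨hτb, h.1⟩⟩, h.2⟩

/-- Up to a boundary, every element has zero coordinate at `b'`. -/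
theorem exists_sub_apply_eq_zero {i : ℕ} {f : TaylorTotal σ k q}
    (hf : f ∈ taylorSupported σ k Ω i) :
    ∃ g ∈ taylorSupported σ k Ω (i + 1), (f - scalarDifferential a c g) b' = 0 := by
  refine ⟨(C (c b' b)⁻¹ * f b') • Pi.single b 1, ?_, ?_⟩
  · by_cases hi : b'.card = i
    · exact single_mem (h.mem hb).2 (by rw [h.card hb, hi]) _
    · rw [hf b' fun h' => hi h'.2, mul_zero, zero_smul]
      exact zero_mem _
  · rw [Pi.sub_apply, scalarDifferential_smul_single hbb, mul_right_comm, C_inv_mul_C hb,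
      one_mul, sub_self]

theorem exists_scalarDifferential_cancelEmbedding_eq {i : ℕ} {f : TaylorTotal σ k q}
    (hf : f ∈ taylorSupported σ k Ω i) (hf0 : scalarDifferential a c f b' = 0) :
    ∃ g ∈ taylorSupported σ k ((Ω.erase b).erase b') i,
      scalarDifferential a c (cancelEmbedding a c b' b g) = scalarDifferential a c f := by
  have hne := h.ne_of_coeff_ne_zero hb
  obtain ⟨p, hp, hp'⟩ := h.exists_sub_apply_eq_zero hb hbb hf
  set f₁ := f - scalarDifferential a c p with hf₁
  have hDf₁ : scalarDifferential a c f₁ = scalarDifferential a c f := by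
    rw [hf₁, map_sub, h.comp_self, sub_zero]
  have hf₁mem : f₁ ∈ taylorSupported σ k Ω i := sub_mem hf (h.map_mem hp)
  -- Dropping the `b` coordinate loses nothing: as `D f₁` vanishes at `b'`, `cancelEmbedding`
  -- restores that coordinate.
  refine ⟨f₁ - f₁ b • Pi.single b 1, mem_taylorSupported_cancel (sub_mem hf₁mem ?_) ?_ ?_, ?_⟩
  · by_cases hi : b.card = i
    · exact single_mem (h.mem hb).2 hi _
    · rw [hf₁mem b fun h' => hi h'.2, zero_smul]
      exact zero_mem _
  · simp
  · rw [Pi.sub_apply, Pi.smul_apply, Pi.single_eq_of_ne hne.symm, hp', smul_zero, sub_zero]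
  · rw [← hDf₁]
    congr 1
    rw [cancelEmbedding, map_sub, Pi.sub_apply, hDf₁, hf0, zero_sub,
      scalarDifferential_smul_single hbb, mul_neg, mul_left_comm, C_inv_mul_C hb, mul_one,
      neg_smul, sub_neg_eq_add, sub_add_cancel]

omit hb hbb in
theorem cancelEmbedding_of_mem_zero {f : TaylorTotal σ k q}
    (hf : f ∈ taylorSupported σ k Ω 0) : cancelEmbedding a c b' b f = f := by
  rw [cancelEmbedding, h.map_eq_zero hf, Pi.zero_apply, mul_zero, zero_smul, sub_zero]

/-- Cancelling a unit coefficient in a multigraded resolution. -/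
theorem cancel : IsScalarResolution I a ((Ω.erase b).erase b') (cancelCoeff Ω c b' b) := by
  have hor : ∀ {τ' τ}, cancelCoeff Ω c b' b τ' τ ≠ 0 →
      c τ' τ ≠ 0 ∨ (c τ' b ≠ 0 ∧ c b' τ ≠ 0) := fun {τ' τ} hc => by
    by_contra! hcon
    apply hc
    rw [cancelCoeff]
    split_ifs
    · rw [hcon.1]
      by_cases h1 : c τ' b = 0
      · simp [h1]
      · simp [hcon.2 h1]
    · rfl
  have hD : ∀ (f : TaylorTotal σ k q), ∀ τ ∉ (Ω.erase b).erase b',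
      scalarDifferential a (cancelCoeff Ω c b' b) f τ = 0 := fun f τ hτ =>
    cancelCoeff_apply_eq_zero f hτ
  have hDapply : ∀ f g : TaylorTotal σ k q, (∀ τ ∈ (Ω.erase b).erase b', f τ = g τ) →
      scalarDifferential a (cancelCoeff Ω c b' b) f =
        scalarDifferential a (cancelCoeff Ω c b' b) g := fun f g hfg => by
    funext τ'
    rw [scalarDifferential_apply, scalarDifferential_apply]
    refine Finset.sum_congr rfl fun τ _ => ?_
    by_cases hτ : τ ∈ (Ω.erase b).erase b'
    · rw [hfg τ hτ]
    · rw [cancelCoeff, if_neg fun h => hτ h.2, monomial_zero, zero_mul, zero_mul]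
  -- Boundaries can be detected after embedding. Exactness and the description of the kernel of the
  -- augmentation both reduce to this.
  have hexact : ∀ {i : ℕ} {f : TaylorTotal σ k q},
      f ∈ taylorSupported σ k ((Ω.erase b).erase b') i →
      (∃ g ∈ taylorSupported σ k Ω (i + 1),
        scalarDifferential a c g = cancelEmbedding a c b' b f) →
      ∃ g ∈ taylorSupported σ k ((Ω.erase b).erase b') (i + 1),
        scalarDifferential a (cancelCoeff Ω c b' b) g = f := by
    rintro i f hf ⟨g, hg, hgf⟩
    have hb0 : scalarDifferential a c g b' = 0 := by
      rw [hgf, cancelEmbedding, Pi.sub_apply, Pi.smul_apply,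
        Pi.single_eq_of_ne (h.ne_of_coeff_ne_zero hb).symm, smul_zero, sub_zero]
      exact eq_zero_of_mem_taylorSupported hf b' (Finset.notMem_erase _ _)
    obtain ⟨g', hg', hgg'⟩ := h.exists_scalarDifferential_cancelEmbedding_eq hb hbb hg hb0
    refine ⟨g', hg', eq_of_cancelEmbedding_eq (a := a) (c := c) (hD _) (eq_zero_of_mem_taylorSupported hf) ?_⟩
    rw [← h.scalarDifferential_cancelEmbedding hb hbb (eq_zero_of_mem_taylorSupported hg'), hgg',
      hgf]
  refine ⟨fun {τ' τ} hc => ?_, fun {τ' τ} hc => ?_, fun {τ' τ} hc => ?_, fun f => ?_,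
    fun i f hf hf0 => ?_, ?_⟩
  · by_contra hcon
    exact hc (if_neg hcon)
  · rcases hor hc with h1 | ⟨h1, h2⟩
    · exact h.card h1
    · have e1 := h.card h1
      have e2 := h.card h2
      have e3 := h.card hb
      omega
  · rcases hor hc with h1 | ⟨h1, h2⟩
    · exact h.le h1
    · exact (h.le h1).trans (hbb.ge.trans (h.le h2))
  -- The new differential ignores the coordinates outside the smaller basis, so `f` may be truncated
  -- to it before the chain map identity is used.
  · let f' : TaylorTotal σ k q := fun τ => if τ ∈ (Ω.erase b).erase b' then f τ else 0
    rw [hDapply f f' fun τ hτ => (if_pos hτ).symm]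
    have hf' : ∀ τ ∉ (Ω.erase b).erase b', f' τ = 0 := fun τ hτ => if_neg hτ
    refine eq_of_cancelEmbedding_eq (a := a) (c := c) (hD _) (fun _ _ => rfl) ?_
    rw [← h.scalarDifferential_cancelEmbedding hb hbb (hD _),
      ← h.scalarDifferential_cancelEmbedding hb hbb hf', h.comp_self]
    simp [cancelEmbedding]
  · refine hexact hf (h.exact i _ (h.cancelEmbedding_mem hb (taylorSupported_cancel_le _ hf)) ?_)
    rw [h.scalarDifferential_cancelEmbedding hb hbb (eq_zero_of_mem_taylorSupported hf), hf0]
    simp [cancelEmbedding]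
  · obtain ⟨ε, hε, hε'⟩ := h.augmentation
    refine ⟨ε, fun x => ?_, fun f hf => ?_⟩
    · obtain ⟨f, hf, rfl⟩ := hε x
      obtain ⟨g, hg, hg'⟩ := h.exists_sub_apply_eq_zero hb hbb hf
      have hmem := sub_mem hf (h.map_mem hg)
      -- The coordinate at `b` vanishes because `|b| = |b'| + 1` is never zero.
      refine ⟨_, mem_taylorSupported_cancel hmem (hmem b fun h' => ?_) hg', ?_⟩
      · rw [h.card hb] at h'
        exact Nat.succ_ne_zero _ h'.2
      · rw [map_sub, (hε' _ (h.map_mem hg)).2 ⟨g, hg, rfl⟩, sub_zero]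
    · have hf' := taylorSupported_cancel_le _ hf
      rw [hε' f hf']
      constructor
      · intro hg
        rw [← h.cancelEmbedding_of_mem_zero hf'] at hg
        exact hexact hf hg
      · rintro ⟨g, hg, hgf⟩
        refine ⟨_, h.cancelEmbedding_mem hb (taylorSupported_cancel_le _ hg), ?_⟩
        rw [h.scalarDifferential_cancelEmbedding hb hbb (eq_zero_of_mem_taylorSupported hg), hgf,
          h.cancelEmbedding_of_mem_zero hf']

end IsScalarResolution

theorem IsScalarResolution.exists_minimal {I : Ideal (MvPolynomial σ k)}
    (Ω : Finset (Finset (Fin q))) (c : Finset (Fin q) → Finset (Fin q) → k)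
    (h : IsScalarResolution I a Ω c) :
    ∃ Ω' c', IsScalarResolution I a Ω' c' ∧
      ∀ τ' τ, c' τ' τ ≠ 0 → lcmExponent a τ' ≠ lcmExponent a τ := by
  induction Ω using Finset.strongInduction generalizing c with
  | H Ω ih =>
    by_cases hmin : ∀ τ' τ, c τ' τ ≠ 0 → lcmExponent a τ' ≠ lcmExponent a τ
    · exact ⟨Ω, c, h, hmin⟩
    · push Not at hmin
      obtain ⟨b', b, hb, hbb⟩ := hmin
      exact ih _ ((Finset.erase_subset _ _).trans_ssubset (Finset.erase_ssubset (h.mem hb).2)) _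
        (h.cancel hb hbb)

/-- The scalar coefficients of the Taylor differential. -/
def taylorScalar (k : Type*) [Field k] (τ' τ : Finset (Fin q)) : k :=
  ∑ j ∈ τ, if τ' = τ.erase j then incidenceSign k j τ else 0

theorem scalarDifferential_taylorScalar (a : Fin q → σ →₀ ℕ) :
    scalarDifferential a (taylorScalar k) = taylorTotalDifferential k a := by
  refine congrArg Matrix.mulVecLin (congrArg Matrix.of ?_)
  funext τ' τ
  rw [taylorScalar, map_sum, taylorCoeff]
  refine Finset.sum_congr rfl fun j _ => ?_
  split_ifs
  · rw [incidenceSign, ← mul_one ((-1 : k) ^ _), ← C_mul_monomial, map_pow, map_neg, C_1]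
  · exact monomial_zero

theorem taylor_isScalarResolution {I : Ideal (MvPolynomial σ k)}
    (hI : I = Ideal.span (Set.range fun j => monomial (a j) (1 : k))) :
    IsScalarResolution I a Finset.univ (taylorScalar k) := by
  have hlow := isLowerSet_coe_univ (q := q)
  have hres := taylor_univ_isFreeResolution hI
  have hex : ∀ {τ' τ : Finset (Fin q)}, taylorScalar k τ' τ ≠ 0 → ∃ j ∈ τ, τ' = τ.erase j :=
    fun {τ' τ} hc => by
      obtain ⟨j, hj, h⟩ := Finset.exists_ne_zero_of_sum_ne_zero hc
      exact ⟨j, hj, by_contra fun h' => h (if_neg h')⟩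
  refine ⟨fun _ => ⟨Finset.mem_univ _, Finset.mem_univ _⟩, fun hc => ?_, fun hc => ?_,
    fun f => ?_, fun i f hf hf0 => ?_, ?_⟩
  · obtain ⟨j, hj, rfl⟩ := hex hc
    rw [Finset.card_erase_add_one hj]
  · obtain ⟨j, hj, rfl⟩ := hex hc
    exact lcmExponent_mono a (Finset.erase_subset _ _)
  · rw [scalarDifferential_taylorScalar, taylorTotalDifferential_comp_self]
  · rw [scalarDifferential_taylorScalar] at hf0 ⊢
    obtain ⟨g, hg⟩ := (hres.exact i fun τ => f τ.1).1 (by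
      apply taylorExtend_injective
      rw [← taylorTotalDifferential_taylorExtend hlow, taylorExtend_restrict _ hf, hf0, map_zero])
    refine ⟨taylorExtend _ _ g, fun τ hτ => taylorExtend_apply_of_not g hτ, ?_⟩
    rw [taylorTotalDifferential_taylorExtend hlow, hg, taylorExtend_restrict _ hf]
  · obtain ⟨e⟩ := hres.homology_zero
    refine ⟨e.toLinearMap ∘ₗ Submodule.mkQ _ ∘ₗ LinearMap.funLeft _ _ Subtype.val, fun x => ?_,
      fun f hf => ?_⟩
    · obtain ⟨y, rfl⟩ := e.surjective x
      obtain ⟨f, rfl⟩ := Submodule.mkQ_surjective _ y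
      refine ⟨taylorExtend _ _ f, fun τ hτ => taylorExtend_apply_of_not f hτ, ?_⟩
      exact congrArg (fun y => e (Submodule.Quotient.mk y))
        (funext fun τ => taylorExtend_apply f τ)
    · rw [scalarDifferential_taylorScalar, LinearMap.comp_apply, LinearMap.comp_apply,
        LinearEquiv.coe_coe, LinearEquiv.map_eq_zero_iff, Submodule.mkQ_apply,
        Submodule.Quotient.mk_eq_zero]
      constructor
      · rintro ⟨g, hg⟩
        refine ⟨taylorExtend _ _ g, fun τ hτ => taylorExtend_apply_of_not g hτ, ?_⟩
        rw [taylorTotalDifferential_taylorExtend hlow, hg]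
        exact taylorExtend_restrict _ hf
      · rintro ⟨g, hg, hgf⟩
        refine ⟨fun τ => g τ.1, ?_⟩
        apply taylorExtend_injective
        rw [← taylorTotalDifferential_taylorExtend hlow, taylorExtend_restrict _ hg, hgf]
        exact (taylorExtend_restrict _ hf).symm

/-- The quotient by a monomial ideal has a minimal free resolution. -/
theorem exists_isMinimalFreeResolution (I : Ideal (MvPolynomial σ k)) (a : Fin q → σ →₀ ℕ)
    (hI : I = Ideal.span (Set.range fun j => monomial (a j) (1 : k))) :
    ∃ (Ω : Finset (Finset (Fin q))) (d : ∀ i, TaylorModule σ k Ω (i + 1) →ₗ[MvPolynomial σ k]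
      TaylorModule σ k Ω i),
      IsMinimalFreeResolution (irrelevantIdeal σ k) (MvPolynomial σ k ⧸ I)
        (TaylorModule σ k Ω) d := by
  obtain ⟨Ω, c, h, hmin⟩ := IsScalarResolution.exists_minimal _ _ (taylor_isScalarResolution hI)
  exact ⟨Ω, h.exists_isMinimalFreeResolution hmin⟩

end MinimalResolution

/-! ### Pivot complexes and when they resolve. -/

section Pivot

open MvPolynomial

variable {σ k : Type*} [Field k] {q : ℕ}

/-- The family of all index sets that do not contain `S`. -/
def pivotFamily (S : Finset (Fin q)) : Finset (Finset (Fin q)) :=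
  Finset.univ.filter fun τ => ¬ S ⊆ τ

theorem mem_pivotFamily {S τ : Finset (Fin q)} : τ ∈ pivotFamily S ↔ ¬ S ⊆ τ := by
  simp [pivotFamily]

theorem isLowerSet_pivotFamily (S : Finset (Fin q)) :
    IsLowerSet (pivotFamily S : Set (Finset (Fin q))) := fun τ τ' h hτ => by
  rw [Finset.mem_coe, mem_pivotFamily] at hτ ⊢
  exact fun h' => hτ (h'.trans h)

/-- If `m_S ∣ x^u`, then `i` is an apex: inserting an element outside `S` cannot complete `S`. If
not, no index set admissible in multidegree `u` contains `S`, so every generator dividing `x^u` is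
an apex. -/
theorem isConical_pivotFamily {a : Fin q → σ →₀ ℕ} {S : Finset (Fin q)} {i : Fin q} (hi : i ∉ S)
    (h : a i ≤ lcmExponent a S) : IsConical a (pivotFamily S) := by
  rintro u ⟨j, hj⟩
  simp only [mem_pivotFamily]
  by_cases hS : lcmExponent a S ≤ u
  · exact ⟨i, h.trans hS, fun τ hτ _ h' => hτ ((Finset.subset_insert_iff_of_notMem hi).1 h')⟩
  · refine ⟨j, hj, fun τ _ hu h' => hS ((lcmExponent_mono a h').trans ?_)⟩
    rw [lcmExponent_le_iff] at hu ⊢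
    simpa [hj] using hu

section Resolution

variable {I : Ideal (MvPolynomial σ k)} {a : Fin q → σ →₀ ℕ}

theorem pivot_isFreeResolution
    (hI : I = Ideal.span (Set.range fun j => monomial (a j) (1 : k))) {S : Finset (Fin q)}
    (hS : 2 ≤ S.card) {i : Fin q} (hi : i ∉ S) (h : a i ≤ lcmExponent a S) :
    IsFreeResolution (MvPolynomial σ k ⧸ I) (TaylorModule σ k (pivotFamily S))
      (taylorDifferential k a (pivotFamily S)) := by
  refine taylor_isFreeResolution hI (isLowerSet_pivotFamily S) (isConical_pivotFamily hi h)
    (mem_pivotFamily.2 fun h => ?_) fun j => mem_pivotFamily.2 fun h => ?_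
  · have := Finset.card_le_card h
    rw [Finset.card_empty] at this
    omega
  · have := Finset.card_le_card h
    rw [Finset.card_singleton] at this
    omega

/-- If the pivot complex of `S` is acyclic, then some generator outside of `S` divides `m_S`. -/
theorem exists_notMem_le_lcmExponent_of_exact {S : Finset (Fin q)} {n : ℕ} (hS : S.card = n + 2)
    (hex : Function.Exact (taylorDifferential k a (pivotFamily S) (n + 1))
      (taylorDifferential k a (pivotFamily S) n)) :
    ∃ i ∉ S, a i ≤ lcmExponent a S := by
  by_contra! hne
  -- This is `ε_S` itself, as the exponent is zero. Its boundary lies in the pivot complex, since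
  -- each face misses an element of `S`.
  set e : TaylorTotal σ k q := taylorElement k a (lcmExponent a S) S with he
  have heS : ∀ τ, τ ≠ S → e τ = 0 := fun τ hτ => Pi.single_eq_of_ne hτ _
  have hz : ∀ τ, ¬ (τ ∈ pivotFamily S ∧ τ.card = n + 1) → taylorTotalDifferential k a e τ = 0 := by
    intro τ hτ
    rw [taylorTotalDifferential_apply]
    refine Finset.sum_eq_zero fun τ' _ => ?_
    by_cases h : τ' = S
    · subst h
      rw [taylorCoeff_eq_zero, zero_mul]
      rintro j hj rfl
      refine hτ ⟨mem_pivotFamily.2 fun h => Finset.notMem_erase j _ (h hj), ?_⟩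
      rw [Finset.card_erase_of_mem hj, hS]
      rfl
    · rw [heS τ' h, mul_zero]
  obtain ⟨w, hw⟩ := (hex fun τ => taylorTotalDifferential k a e τ.1).1 (by
    apply taylorExtend_injective
    rw [← taylorTotalDifferential_taylorExtend (isLowerSet_pivotFamily S),
      taylorExtend_restrict _ hz, taylorTotalDifferential_comp_self, map_zero])
  have hg : ∀ τ, ¬ (τ ∈ (Finset.univ : Finset (Finset (Fin q))) ∧ τ.card = n + 2) →
      (e - taylorExtend (pivotFamily S) (n + 2) w) τ = 0 := fun τ hτ => by
    have hτ' : τ.card ≠ n + 2 := fun h => hτ ⟨Finset.mem_univ _, h⟩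
    rw [Pi.sub_apply, heS τ fun h => hτ' (h ▸ hS), taylorExtend_apply_of_not _ fun h => hτ' h.2,
      sub_zero]
  -- With `w` in the pivot complex and `∂w = ∂ε_S`, the cycle `ε_S - w` bounds some `v` in the
  -- Taylor complex. Its coefficient at `ε_S` is `1`, whereas that of `∂v` lies in `𝔪` when no
  -- generator outside `S` divides `m_S`.
  obtain ⟨v, hv⟩ := (taylorDifferential_exact isLowerSet_coe_univ (isConical_univ a) (n + 1)
      fun τ => (e - taylorExtend (pivotFamily S) (n + 2) w) τ.1).1 (by
    apply taylorExtend_injective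
    rw [← taylorTotalDifferential_taylorExtend isLowerSet_coe_univ, taylorExtend_restrict _ hg,
      map_sub, taylorTotalDifferential_taylorExtend (isLowerSet_pivotFamily S), hw,
      taylorExtend_restrict _ hz, sub_self, map_zero])
  have hv' := congrFun hv ⟨S, Finset.mem_univ _, hS⟩
  have h1 : (e - taylorExtend (pivotFamily S) (n + 2) w) S = 1 := by
    rw [Pi.sub_apply, taylorExtend_apply_of_not _ fun h => mem_pivotFamily.1 h.1 subset_rfl,
      he, taylorElement, Pi.single_eq_same, tsub_self, sub_zero]
    rfl
  rw [h1] at hv'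
  refine irrelevantIdeal_isMaximal (σ := σ) (k := k).ne_top ((Ideal.eq_top_iff_one _).2 ?_)
  rw [← hv']
  change ∑ τ : TaylorIndex Finset.univ (n + 1 + 1 + 1), taylorCoeff k a τ.1 S * v τ ∈ _
  refine Ideal.sum_mem _ fun τ _ => Ideal.mul_mem_right _ _ ?_
  by_cases hj : ∃ j ∈ τ.1, S = τ.1.erase j
  · obtain ⟨j, hj, rfl⟩ := hj
    rw [taylorCoeff_erase_mem_iff a hj]
    intro h
    exact hne j (Finset.notMem_erase _ _) (h ▸ Finset.le_sup hj)
  · push Not at hj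
    rw [taylorCoeff_eq_zero hj]
    exact zero_mem _

/-- A generator divisible by another one could be dropped. -/
theorem IsMinimallyGenerated.eq_of_le (hI : IsMinimallyGenerated I a) {i j : Fin q}
    (h : a i ≤ a j) : i = j := by
  by_contra hne
  have := hI.2 {j}ᶜ (by
    rw [hI.1]
    refine le_antisymm (Ideal.span_le.2 ?_) (Ideal.span_mono (Set.image_subset_range _ _))
    rintro _ ⟨l, rfl⟩
    by_cases hl : l = j
    · subst hl
      have h1 : monomial (a l) (1 : k) = monomial (a l - a i) 1 * monomial (a i) 1 := by
        rw [monomial_mul, tsub_add_cancel_of_le h, one_mul]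
      simp only [SetLike.mem_coe]
      rw [h1]
      exact Ideal.mul_mem_left _ _ (Ideal.subset_span ⟨i, hne, rfl⟩)
    · exact Ideal.subset_span ⟨l, hl, rfl⟩)
  exact (this ▸ Set.mem_univ j : j ∈ ({j}ᶜ : Set (Fin q))) rfl

theorem IsMinimallyGenerated.ne_zero (hI : IsMinimallyGenerated I a) (hI' : I ≠ ⊤) (j : Fin q) :
    a j ≠ 0 := fun h => by
  refine hI' ((Ideal.eq_top_iff_one _).2 ?_)
  rw [hI.1]
  refine Ideal.subset_span ⟨j, ?_⟩
  simp [h]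

end Resolution

/-! ### The Scarf number and divisibility of lcms. -/

section Scarf

variable {a : Fin q → σ →₀ ℕ}

theorem lcmExponent_insert_eq {j : Fin q} {τ : Finset (Fin q)} (h : a j ≤ lcmExponent a τ) :
    lcmExponent a (insert j τ) = lcmExponent a τ := by
  refine le_antisymm (lcmExponent_le_iff.2 fun i hi => ?_)
    (lcmExponent_mono a (Finset.subset_insert _ _))
  rcases Finset.mem_insert.1 hi with rfl | hi
  · exact h
  · exact Finset.le_sup hi

theorem scarfNumber_le {j : Fin q} {τ : Finset (Fin q)} (hj : j ∉ τ) (h : a j ≤ lcmExponent a τ) :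
    scarfNumber a ≤ τ.card :=
  sInf_le ⟨τ, insert j τ, fun h => hj (h ▸ Finset.mem_insert_self _ _), rfl,
    (lcmExponent_insert_eq h).symm⟩

/-- The Scarf number is attained by an index set `τ` such that a generator outside of `τ`
divides `m_τ`. -/
theorem exists_card_eq_scarfNumber (h : scarfNumber a ≠ ⊤) :
    ∃ (τ : Finset (Fin q)) (j : Fin q), (τ.card : ℕ∞) = scarfNumber a ∧ j ∉ τ ∧
      a j ≤ lcmExponent a τ := by
  have hne : {t : ℕ∞ | ∃ τ τ' : Finset (Fin q),
      τ ≠ τ' ∧ (τ.card : ℕ∞) = t ∧ lcmExponent a τ = lcmExponent a τ'}.Nonempty := by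
    by_contra hne
    rw [Set.not_nonempty_iff_eq_empty] at hne
    exact h (by rw [scarfNumber, hne, sInf_empty])
  obtain ⟨τ, τ', hττ', hcard, heq⟩ := csInf_mem hne
  -- A proper subset of `τ` with the same lcm would have smaller cardinality than the minimum.
  by_cases hsub : τ' ⊆ τ
  · have h1 : scarfNumber a ≤ τ'.card := sInf_le ⟨τ', τ, hττ'.symm, rfl, heq.symm⟩
    have h2 : τ'.card < τ.card :=
      Finset.card_lt_card (hsub.ssubset_of_ne hττ'.symm)
    have h3 : (τ.card : ℕ∞) ≤ τ'.card := hcard.trans_le h1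
    exact absurd (Nat.cast_le.1 h3) h2.not_ge
  · obtain ⟨j, hj, hj'⟩ := Finset.not_subset.1 hsub
    exact ⟨τ, j, hcard, hj', heq ▸ Finset.le_sup hj⟩

theorem scarfNumber_eq_top_iff :
    scarfNumber a = ⊤ ↔ ∀ τ : Finset (Fin q), ∀ j ∈ τ, lcmExponent a (τ.erase j) ≠ lcmExponent a τ
    := by
  constructor
  · intro h τ j hj heq
    have := scarfNumber_le (Finset.notMem_erase j τ) ((Finset.le_sup (f := a) hj).trans heq.ge)
    rw [h] at this
    exact absurd this (by simp)
  · intro h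
    by_contra hne
    obtain ⟨τ, j, -, hj, hle⟩ := exists_card_eq_scarfNumber hne
    refine h (insert j τ) j (Finset.mem_insert_self _ _) ?_
    rw [Finset.erase_insert hj, lcmExponent_insert_eq hle]

/-- The Scarf number is `|S|` if the pivot complex of `S` is minimal and a generator outside of
`S` divides `m_S`. -/
theorem scarfNumber_eq_card {S : Finset (Fin q)} {i : Fin q} (hi : i ∉ S)
    (h : a i ≤ lcmExponent a S)
    (hmin : ∀ τ ∈ pivotFamily S, ∀ j ∈ τ, lcmExponent a (τ.erase j) ≠ lcmExponent a τ) :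
    scarfNumber a = S.card := by
  have hle := scarfNumber_le hi h
  obtain ⟨τ, j, hτ, hj, hle'⟩ := exists_card_eq_scarfNumber
    (ne_top_of_le_ne_top (ENat.natCast_ne_top _) hle)
  rw [← hτ] at hle ⊢
  have hle : τ.card ≤ S.card := Nat.cast_le.1 hle
  by_contra hne
  have hlt : τ.card < S.card := hle.lt_of_ne fun h => hne (by rw [h])
  -- Otherwise the pivot complex would contain the unit coefficient from `τ ∪ {j}` to `τ`. As `|τ| <
  -- |S|`, it follows that `S = τ ∪ {j}`.
  have hS : S ⊆ insert j τ := by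
    by_contra hS
    refine hmin _ (mem_pivotFamily.2 hS) j (Finset.mem_insert_self _ _) ?_
    rw [Finset.erase_insert hj, lcmExponent_insert_eq hle']
  have hS' : S = insert j τ := Finset.eq_of_subset_of_card_le hS (by
    rw [Finset.card_insert_of_notMem hj]
    omega)
  subst hS'
  rw [lcmExponent_insert_eq hle'] at h
  have hiτ : i ∉ τ := fun h => hi (Finset.mem_insert_of_mem h)
  -- Now `m_S = m_τ`, so `m_i ∣ m_τ`; the set `τ ∪ {i}` omits `j ∈ S` and gives a forbidden unit
  -- coefficient.
  refine hmin (insert i τ) (mem_pivotFamily.2 fun h' => ?_) i (Finset.mem_insert_self _ _) ?_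
  · rcases Finset.mem_insert.1 (h' (Finset.mem_insert_self j τ)) with rfl | h'
    · exact hi (Finset.mem_insert_self _ _)
    · exact hj h'
  · rw [Finset.erase_insert hiτ, lcmExponent_insert_eq h]

end Scarf

/-! ### Ranks of the pivot complexes as binomial coefficients. -/

section Counting

theorem card_taylorIndex (Ω : Finset (Finset (Fin q))) (i : ℕ) :
    Fintype.card (TaylorIndex Ω i) = (Ω.filter fun τ => τ.card = i).card := by
  rw [Fintype.card_subtype]
  congr 1
  ext τ
  simp

theorem card_filter_card_eq (i : ℕ) :
    ((Finset.univ : Finset (Finset (Fin q))).filter fun τ => τ.card = i).card = q.choose i := by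
  rw [Finset.univ_filter_card_eq, Finset.card_powersetCard, Finset.card_univ, Fintype.card_fin]

theorem card_filter_superset (S : Finset (Fin q)) (i : ℕ) :
    ((Finset.univ : Finset (Finset (Fin q))).filter fun τ => S ⊆ τ ∧ τ.card = i + S.card).card =
      (q - S.card).choose i := by
  have h : q - S.card = (Finset.univ \ S).card := by
    rw [Finset.card_sdiff_of_subset (Finset.subset_univ S), Finset.card_univ, Fintype.card_fin]
  rw [h, ← Finset.card_powersetCard]
  refine Finset.card_nbij' (fun τ => τ \ S) (fun τ => τ ∪ S) ?_ ?_ ?_ ?_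
  · intro τ hτ
    simp only [Finset.coe_filter, Finset.mem_univ, true_and, Set.mem_ofPred_eq] at hτ
    simp only [Finset.mem_coe, Finset.mem_powersetCard]
    refine ⟨Finset.sdiff_subset_sdiff (Finset.subset_univ _) subset_rfl, ?_⟩
    rw [Finset.card_sdiff_of_subset hτ.1, hτ.2, Nat.add_sub_cancel]
  · intro τ hτ
    simp only [Finset.mem_coe, Finset.mem_powersetCard] at hτ
    simp only [Finset.coe_filter, Finset.mem_univ, true_and, Set.mem_ofPred_eq]
    refine ⟨Finset.subset_union_right, ?_⟩
    rw [Finset.card_union_of_disjoint (Finset.disjoint_of_subset_left hτ.1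
      Finset.sdiff_disjoint), hτ.2]
  · intro τ hτ
    simp only [Finset.coe_filter, Finset.mem_univ, true_and, Set.mem_ofPred_eq] at hτ
    exact Finset.sdiff_union_of_subset hτ.1
  · intro τ hτ
    simp only [Finset.mem_coe, Finset.mem_powersetCard] at hτ
    exact Finset.union_sdiff_cancel_right (Finset.disjoint_of_subset_left hτ.1
      Finset.sdiff_disjoint)

theorem card_taylorIndex_univ (i : ℕ) :
    Fintype.card (TaylorIndex (Finset.univ : Finset (Finset (Fin q))) i) = q.choose i := by
  rw [card_taylorIndex, card_filter_card_eq]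

theorem card_taylorIndex_pivotFamily (S : Finset (Fin q)) (i : ℕ) :
    (Fintype.card (TaylorIndex (pivotFamily S) i) : ℤ) =
      q.choose i - if S.card ≤ i then ((q - S.card).choose (i - S.card) : ℤ) else 0 := by
  have h := Finset.card_filter_add_card_filter_not (s := Finset.univ.filter
    fun τ : Finset (Fin q) => τ.card = i) (fun τ => S ⊆ τ)
  rw [card_filter_card_eq, Finset.filter_filter, Finset.filter_filter] at h
  have h1 : Fintype.card (TaylorIndex (pivotFamily S) i) =
      (Finset.univ.filter fun τ : Finset (Fin q) => τ.card = i ∧ ¬ S ⊆ τ).card := by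
    rw [card_taylorIndex, pivotFamily, Finset.filter_filter]
    simp only [and_comm]
  have h2 : (Finset.univ.filter fun τ : Finset (Fin q) => τ.card = i ∧ S ⊆ τ).card =
      if S.card ≤ i then (q - S.card).choose (i - S.card) else 0 := by
    split_ifs with hi
    · rw [← card_filter_superset, Nat.sub_add_cancel hi]
      simp only [and_comm]
    · rw [Finset.card_eq_zero, Finset.filter_eq_empty_iff]
      rintro τ - ⟨rfl, hS⟩
      exact hi (Finset.card_le_card hS)
  rw [h1, ← h, h2]
  push_cast
  ring

theorem intBinom_natCast (n i : ℕ) : intBinom n i = n.choose i := by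
  simp [intBinom, Ring.choose_natCast]

theorem intBinom_of_neg (n : ℤ) {i : ℤ} (hi : i < 0) : intBinom n i = 0 :=
  if_neg hi.not_ge

theorem shiftedBinom_of_neg {i : ℤ} (hi : i < 0) (s : ℕ∞) : shiftedBinom q i s = 0 := by
  rw [shiftedBinom]
  split_ifs
  · rfl
  · exact intBinom_of_neg _ (by omega)

/-- The bound `s ≤ q` keeps the upper entry nonnegative; for negative upper entries `Ring.choose` is
not the truncated binomial coefficient. -/
theorem shiftedBinom_natCast (i : ℕ) {s : ℕ} (hs : s ≤ q) :
    shiftedBinom q i s = if s ≤ i then ((q - s).choose (i - s) : ℤ) else 0 := by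
  rw [shiftedBinom, if_neg (ENat.natCast_ne_top s), ENat.toNat_natCast, ← Nat.cast_sub hs]
  split_ifs with h
  · rw [← Nat.cast_sub h, intBinom_natCast]
  · exact intBinom_of_neg _ (by omega)

end Counting

/-! ### The pivot resolution attached to the Scarf number. -/

section Bound

variable {I : Ideal (MvPolynomial σ k)} {a : Fin q → σ →₀ ℕ}

theorem finrank_taylor_univ (i : ℕ) :
    (Module.finrank (MvPolynomial σ k) (TaylorModule σ k (Finset.univ : Finset (Finset (Fin q))) i)
      : ℤ) = intBinom q i - shiftedBinom q i ⊤ := by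
  rw [Module.finrank_fintype_fun_eq_card, card_taylorIndex_univ, intBinom_natCast, shiftedBinom,
    if_pos rfl, sub_zero]

theorem finrank_pivot (S : Finset (Fin q)) (i : ℕ) :
    (Module.finrank (MvPolynomial σ k) (TaylorModule σ k (pivotFamily S) i) : ℤ) =
      intBinom q i - shiftedBinom q i S.card := by
  rw [Module.finrank_fintype_fun_eq_card, card_taylorIndex_pivotFamily, intBinom_natCast,
    shiftedBinom_natCast]
  simpa using Finset.card_le_univ S

/-- There is a pivot complex that resolves `Q/I` and has the expected ranks. -/
theorem IsMinimallyGenerated.exists_pivot_resolution (hI : IsMinimallyGenerated I a)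
    (hI' : I ≠ ⊤) :
    ∃ Ω : Finset (Finset (Fin q)), IsPivotFamily Ω ∧
      IsFreeResolution (MvPolynomial σ k ⧸ I) (TaylorModule σ k Ω) (taylorDifferential k a Ω) ∧
      ∀ i : ℕ, (Module.finrank (MvPolynomial σ k) (TaylorModule σ k Ω i) : ℤ) =
        intBinom q i - shiftedBinom q i (scarfNumber a) := by
  by_cases hs : scarfNumber a = ⊤
  · rw [hs]
    exact ⟨Finset.univ, Or.inl rfl, taylor_univ_isFreeResolution hI.1, finrank_taylor_univ⟩
  · obtain ⟨S, i, hS, hi, hle⟩ := exists_card_eq_scarfNumber hs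
    -- If `S` is empty, some generator is `1`, against properness; if `S` is a singleton, one
    -- generator divides another, against minimal generation.
    have hS2 : 2 ≤ S.card := by
      by_contra! hlt
      interval_cases h : S.card
      · rw [Finset.card_eq_zero.1 h, lcmExponent_empty] at hle
        exact hI.ne_zero hI' i (nonpos_iff_eq_zero.1 hle)
      · obtain ⟨j, rfl⟩ := Finset.card_eq_one.1 h
        rw [lcmExponent_singleton] at hle
        exact hi (Finset.mem_singleton.2 (hI.eq_of_le hle))
    rw [← hS]
    exact ⟨pivotFamily S, Or.inr ⟨S, hS2, rfl⟩, pivot_isFreeResolution hI.1 hS2 hi hle,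
      finrank_pivot S⟩

/-- The ranks of a minimal pivot resolution. -/
theorem IsMinimalFreeResolution.finrank_pivot {Ω : Finset (Finset (Fin q))} (hΩ : IsPivotFamily Ω)
    (h : IsMinimalFreeResolution (irrelevantIdeal σ k) (MvPolynomial σ k ⧸ I)
      (TaylorModule σ k Ω) (taylorDifferential k a Ω)) (i : ℕ) :
    (Module.finrank (MvPolynomial σ k) (TaylorModule σ k Ω i) : ℤ) =
      intBinom q i - shiftedBinom q i (scarfNumber a) := by
  rcases hΩ with rfl | ⟨S, hS, hΩ⟩
  · have hmin := (range_taylorDifferential_le_iff isLowerSet_coe_univ a).1 h.minimal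
    rw [scarfNumber_eq_top_iff.2 fun τ => hmin τ (Finset.mem_univ _), finrank_taylor_univ]
  · change Ω = pivotFamily S at hΩ
    subst hΩ
    -- Since `|S| = n + 2`, the cycle `∂ε_S` sits in the positive degree `n + 1`, where the homology
    -- vanishes.
    obtain ⟨n, hn⟩ := Nat.exists_eq_add_of_le' hS
    obtain ⟨j, hj, hle⟩ := exists_notMem_le_lcmExponent_of_exact hn (h.exact n)
    have hmin := (range_taylorDifferential_le_iff (isLowerSet_pivotFamily S) a).1 h.minimal
    rw [scarfNumber_eq_card hj hle hmin, _root_.finrank_pivot]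

end Bound

end Pivot

theorem corollary3p9 {σ k : Type*} [Field k] {q : ℕ} (a : Fin q → σ →₀ ℕ)
    (I : Ideal (MvPolynomial σ k)) (hI : IsMinimallyGenerated I a) (hI_proper : I ≠ ⊤) :
    (∀ i : ℤ,
      (bettiNumber (irrelevantIdeal σ k) (MvPolynomial σ k ⧸ I) i : ℤ) ≤
        intBinom q i - shiftedBinom q i (scarfNumber a)) ∧
    ((∀ i : ℤ,
      (bettiNumber (irrelevantIdeal σ k) (MvPolynomial σ k ⧸ I) i : ℤ) =
        intBinom q i - shiftedBinom q i (scarfNumber a)) ↔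
      HasMinimalPivotResolution I a) := by
  -- The minimal resolution `hF` computes the Betti numbers and is compared with the pivot
  -- resolution `hP`, which need not be minimal.
  obtain ⟨Ω₀, d, hF⟩ := exists_isMinimalFreeResolution I a hI.1
  obtain ⟨Ω, hΩ, hP, hrank⟩ := hI.exists_pivot_resolution hI_proper
  refine ⟨fun i => ?_, fun h => ⟨Ω, hΩ, hF.of_finrank_eq hP fun i => ?_⟩, ?_⟩
  · rw [hF.bettiNumber_eq]
    rcases lt_or_ge i 0 with hi | hi
    · rw [if_neg hi.not_ge, intBinom_of_neg _ hi, shiftedBinom_of_neg hi]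
      simp
    · lift i to ℕ using hi
      rw [if_pos (Int.natCast_nonneg i), Int.toNat_natCast, ← hrank]
      exact Nat.cast_le.2 (hF.finrank_le hP i)
  · have h1 := h i
    rw [hF.bettiNumber_eq, if_pos (Int.natCast_nonneg i), Int.toNat_natCast, ← hrank] at h1
    exact Nat.cast_injective h1
  · rintro ⟨Ω', hΩ', h⟩ i
    rw [h.bettiNumber_eq]
    rcases lt_or_ge i 0 with hi | hi
    · rw [if_neg hi.not_ge, intBinom_of_neg _ hi, shiftedBinom_of_neg hi]
      simp
    · lift i to ℕ using hi
      rw [if_pos (Int.natCast_nonneg i), Int.toNat_natCast, h.finrank_pivot hΩ']
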